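/- Let $N$ be a free abelian group of rank $r$, $M=\mathrm{Hom}(N,\mathbf Z)$, and let $K\subset N\otimes\mathbf R$ be a rational polyhedral cone with $K-K=N\otimes\mathbf R$ and $K\cap(-K)=\{0\}$. Assume that $K$ is graded: there is $\deg\in M$ which takes the value $1$ on the integer generators of all one-dimensional faces of $K$. Let $K^{open}$ be the interior of $K$. Let $e_1,\dots,e_d$ be distinct lattice points of degree $1$ in $K$ with $\sum_i\mathbf R_{\ge 0}e_i=K$. Let $T$ be a regular triangulation of $K$ based on the $e_i$ (that is, into simplicial cones $\sum_{i\in I}\mathbf R_{\ge0}e_i$ whose maximal members are the domains of linearity of a convex piecewise linear function on $K$) which is maximum, i.e. all $e_i$ are vertices of $T$. Let $\xi\in K^{open}$ be generic: for every $I\in T$ with $r$ elements, all the coefficients $\beta_{I,i}$ in $\xi=\sum_{i\in I}\beta_{I,i}e_i$ are nonzero. For such $I$ let $B_{I,\xi}$ be the set of all $b\in N$ of the form $b=\sum_{i\in I}\gamma_ie_i$ with $0<\gamma_i\le 1$ if $\beta_{I,i}<0$ and $0\le\gamma_i<1$ if $\beta_{I,i}>0$; let $B_{I,-\xi}$ be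 defined in the same way with $-\xi$ in place of $\xi$. Let $R=\mathbf C[K\cap N]$ be the semigroup ring, with basis $x^n$ $(n\in K\cap N)$, and let $R^{open}\subset R$ be the ideal spanned by the $x^n$ with $n\in K^{open}\cap N$. Fix a basis $m_1,\dots,m_r$ of $M\otimes\mathbf C$. For $a=(a_1,\dots,a_d)\in\mathbf C^d$ let $Z$ be the ideal of $R$ generated by the elements $$Z_j=\sum_{i=1}^d\langle m_j,e_i\rangle\, e^{2\pi \mathrm i a_i}\,x^{e_i},\qquad j=1,\dots,r.$$ Let $$S(t)=(1-t)^r\sum_{n\in K\cap N}t^{\deg n},\qquad T(t)=(1-t)^r\sum_{n\in K^{open}\cap N}t^{\deg n}.$$ Then for generic $a$, that is, whenever $P(e^{2\pi \mathrm i a_1},\dots,e^{2\pi \mathrm i a_d})\ne0$ for a certain nonzero polynomial $P\in\mathbf C[y_1,\dots,y_d]$, the following holds. 1. The maps $$\bigoplus_{b\in\bigcup_I B_{I,\xi}}\mathbf C\,[x^b]\to R/ZR,\qquad \bigoplus_{b\in\bigcup_I B_{I,-\xi}}\mathbf C\,[x^b]\to R^{open}/ZR^{open},$$ which send $[x^b]$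 to the class of $x^b$, are bijective. Here $I$ runs over the elements of $T$ with $r$ elements. 2. The spaces $R/ZR$ and $R^{open}/ZR^{open}$ are finite-dimensional, each is the direct sum of its graded parts (the part of degree $k\ge0$ is spanned by the classes of the $x^n$ with $\deg n=k$), and their graded dimensions $\sum_k t^k\dim(\cdot)_k$ are $S(t)$ and $T(t)$ respectively. -/

import Mathlib

open scoped PowerSeries

noncomputable section

/-- The cone `∑_{i ∈ I} ℝ_{≥0} e_i` spanned by the vectors `e_i` with `i ∈ I`. -/
def simplexCone {V : Type*} [AddCommGroup V] [Module ℝ V] {d : ℕ} (e : Fin d → V)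
    (I : Finset (Fin d)) : PointedCone ℝ V :=
  PointedCone.hull ℝ (e '' (I : Set (Fin d)))

/-- `T` (a finite family of subsets `I` of the index set, each standing for the simplex with
vertices `e_i`, `i ∈ I`, or for the simplicial cone over it) is a triangulation of the cone `K`. -/
structure IsTriangulation {V : Type*} [AddCommGroup V] [Module ℝ V] {d : ℕ} (K : PointedCone ℝ V)
    (e : Fin d → V) (T : Finset (Finset (Fin d))) : Prop where
  /-- every member is a simplex -/
  linearIndependent : ∀ I ∈ T, LinearIndependent ℝ (fun i : I => e i)
  /-- faces of simplices belong to the triangulation -/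
  face_mem : ∀ I ∈ T, ∀ J ⊆ I, J ∈ T
  /-- two simplices meet in their common face -/
  inter : ∀ I ∈ T, ∀ J ∈ T, simplexCone e I ⊓ simplexCone e J = simplexCone e (I ∩ J)
  /-- the simplices cover `K` -/
  cover : ∀ v : V, v ∈ K ↔ ∃ I ∈ T, v ∈ simplexCone e I

/-- A triangulation of `K` is regular if there is a strictly convex function `ψ` on `K` which is
linear on its simplices: `ψ` is convex on `K`, it coincides with a linear function `l` on every
simplex of maximum dimension, and it is strictly above `l` on the rest of `K` (so that the
simplices of maximum dimension are precisely the domains of linearity of `ψ`). -/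
def IsRegularTriangulation {V : Type*} [AddCommGroup V] [Module ℝ V] {d : ℕ} (K : PointedCone ℝ V)
    (e : Fin d → V) (T : Finset (Finset (Fin d))) : Prop :=
  IsTriangulation K e T ∧
    ∃ ψ : V → ℝ, ConvexOn ℝ (K : Set V) ψ ∧
      ∀ I ∈ T, I.card = Module.finrank ℝ V →
        ∃ l : V →ₗ[ℝ] ℝ,
          (∀ v ∈ simplexCone e I, ψ v = l v) ∧
          (∀ v ∈ K, v ∉ simplexCone e I → l v < ψ v)

/-- The combinatorial data: a graded cone `K` in `V = N ⊗ ℝ`, where `N` is a lattice in `V`,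
lattice points `e_1, …, e_d` of degree one in `K` generating `K`, a regular triangulation `T` of
`K` which uses all the `e_i` as vertices, and a generic vector `ξ` in the interior of `K`.

The fields `deg_e` and `K_eq` say that `K` is a rational polyhedral cone, that it contains no line
(`deg` is positive on `K` minus the origin), and that the `e_i`, all of which have degree one,
include the integer generators of all one-dimensional faces of `K`. -/
structure GradedConeData {V : Type*} [NormedAddCommGroup V] [NormedSpace ℝ V]
    (N : Submodule ℤ V) where
  /-- the cone -/
  K : PointedCone ℝ V
  /-- `K - K` is the whole space -/
  full : ∀ v : V, ∃ x ∈ K, ∃ y ∈ K, v = x - y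
  /-- the grading -/
  deg : N →ₗ[ℤ] ℤ
  /-- the number of chosen lattice points of degree one -/
  d : ℕ
  /-- the chosen lattice points of degree one -/
  e : Fin d → N
  e_injective : Function.Injective e
  deg_e : ∀ i, deg (e i) = 1
  K_eq : K = PointedCone.hull ℝ (Set.range fun i => (e i : V))
  /-- the triangulation -/
  T : Finset (Finset (Fin d))
  regular : IsRegularTriangulation K (fun i => (e i : V)) T
  /-- the triangulation is maximum: every `e_i` is one of its vertices -/
  maximum : ∀ i, {i} ∈ T
  /-- the generic vector -/
  ξ : V
  ξ_mem : ξ ∈ interior (K : Set V)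
  /-- genericity of `ξ`: its coordinates in every simplex of maximum dimension are nonzero -/
  ξ_generic : ∀ I ∈ T, I.card = Module.finrank ℝ V →
    ∀ β : Fin d → ℝ, ξ = ∑ i ∈ I, β i • (e i : V) → ∀ i ∈ I, β i ≠ 0

namespace GradedConeData

variable {V : Type*} [NormedAddCommGroup V] [NormedSpace ℝ V] {N : Submodule ℤ V}
  (D : GradedConeData N)

/-- The set `B_{I,η}` of the lattice points `b = ∑_{i ∈ I} γ_i e_i` of the cone of `I` with
`0 < γ_i ≤ 1` if `β_i < 0` and `0 ≤ γ_i < 1` if `β_i > 0`, where `η = ∑_{i ∈ I} β_i e_i`. -/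
def box (I : Finset (Fin D.d)) (η : V) : Set N :=
  {b | ∃ β γ : Fin D.d → ℝ, η = ∑ i ∈ I, β i • (D.e i : V) ∧ (b : V) = ∑ i ∈ I, γ i • (D.e i : V) ∧
    ∀ i ∈ I, 0 ≤ γ i ∧ (β i < 0 → 0 < γ i ∧ γ i ≤ 1) ∧ (0 < β i → 0 ≤ γ i ∧ γ i < 1)}

/-- The union of the sets `B_{I,η}` over all simplices `I` of `T` of maximum dimension. -/
def B (η : V) : Set N :=
  {b | ∃ I ∈ D.T, I.card = Module.finrank ℝ V ∧ b ∈ D.box I η}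

/-- The monoid `K ∩ N`. -/
def points : AddSubmonoid N :=
  D.K.toAddSubmonoid.comap N.subtype.toAddMonoidHom

/-- The semigroup ring `R = ℂ[K]`. -/
abbrev R : Type _ := AddMonoidAlgebra ℂ D.points

/-- The element `x^n` of `R`. -/
def x (n : D.points) : D.R := AddMonoidAlgebra.single n 1

/-- `n` is an interior point, that is, it lies in `K^{open}`. -/
def IsInner (n : D.points) : Prop := ((n : N) : V) ∈ interior (D.K : Set V)

lemma add_mem_interior {u v : V} (hu : u ∈ D.K) (hv : v ∈ interior (D.K : Set V)) :
    u + v ∈ interior (D.K : Set V) := by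
  rw [mem_interior] at hv ⊢
  obtain ⟨U, hUK, hU, hvU⟩ := hv
  refine ⟨(fun w => u + w) '' U, ?_, (isOpenMap_add_left u) U hU, ⟨v, hvU, rfl⟩⟩
  rintro _ ⟨w, hw, rfl⟩
  exact D.K.add_mem hu (hUK hw)

/-- The ideal `R^{open} = ℂ[K^{open}]` of `R`: the elements supported in `K^{open}`. -/
def Ropen : Ideal D.R where
  carrier := {f | ∀ n ∈ f.coeff.support, D.IsInner n}
  zero_mem' := by simp
  add_mem' := by
    classical
    intro f g hf hg n hn
    rw [AddMonoidAlgebra.coeff_add] at hn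
    rcases Finset.mem_union.1 (Finsupp.support_add hn) with h | h
    · exact hf n h
    · exact hg n h
  smul_mem' := by
    classical
    intro f g hg n hn
    obtain ⟨p, -, q, hq, rfl⟩ :=
      Finset.mem_add.1 (AddMonoidAlgebra.support_coeff_mul_subset f g hn)
    exact D.add_mem_interior p.2 (hg q hq)

lemma x_mem_Ropen {n : D.points} (hn : D.IsInner n) : D.x n ∈ D.Ropen := by
  intro k hk
  have : k = n := by
    have h := Finsupp.support_single_subset (show k ∈ (Finsupp.single n (1 : ℂ)).support from hk)
    simpa using h
  exact this ▸ hn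

/-- The element `x^n` of `R^{open}`, for `n` in `K^{open} ∩ N`. -/
def xopen (n : D.points) (hn : D.IsInner n) : D.Ropen := ⟨D.x n, D.x_mem_Ropen hn⟩

lemma e_mem (i : Fin D.d) : D.e i ∈ D.points := by
  change (D.e i : V) ∈ D.K
  rw [D.K_eq]
  exact Submodule.subset_span ⟨i, rfl⟩

lemma sum_mem (I : Finset (Fin D.d)) (γ : Fin D.d → ℝ) (h : ∀ i ∈ I, 0 ≤ γ i) :
    ∑ i ∈ I, γ i • (D.e i : V) ∈ D.K :=
  Submodule.sum_mem _ fun i hi => D.K.smul_mem (h i hi) (D.e_mem i)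

lemma mem_points_of_mem_B {η : V} {b : N} (hb : b ∈ D.B η) : b ∈ D.points := by
  obtain ⟨I, -, -, β, γ, -, hbγ, h⟩ := hb
  change (b : V) ∈ D.K
  rw [hbγ]
  exact D.sum_mem I γ fun i hi => (h i hi).1

lemma isInner_of_mem_B {b : N} (hb : b ∈ D.B (-D.ξ)) :
    D.IsInner ⟨b, D.mem_points_of_mem_B hb⟩ := by
  obtain ⟨I, hI, hcard, β, γ, hβ, hbγ, h⟩ := hb
  have hξ : D.ξ = ∑ i ∈ I, (-β i) • (D.e i : V) := by
    simp only [neg_smul, Finset.sum_neg_distrib, ← hβ, neg_neg]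
  have hne := D.ξ_generic I hI hcard _ hξ
  -- a uniform small multiple of `ξ` can be subtracted
  have key : ∀ i ∈ I, ∀ᶠ ε : ℝ in nhdsWithin 0 (Set.Ioi 0), 0 ≤ γ i + ε * β i := by
    intro i hi
    rcases lt_trichotomy (β i) 0 with hb | hb | hb
    · have hg := ((h i hi).2.1 hb).1
      have ht : Filter.Tendsto (fun ε : ℝ => γ i + ε * β i) (nhdsWithin 0 (Set.Ioi 0))
          (nhds (γ i + 0 * β i)) :=
        (Continuous.tendsto (by fun_prop) 0).mono_left nhdsWithin_le_nhds
      exact (ht.eventually (lt_mem_nhds (by simpa using hg))).mono fun _ hx => le_of_lt hx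
    · exact absurd (by simp [hb]) (hne i hi)
    · filter_upwards [self_mem_nhdsWithin] with ε hε
      have := (h i hi).1
      have := mul_pos (Set.mem_Ioi.1 hε) hb
      linarith
  obtain ⟨ε, hε, hpos⟩ :=
    (((Filter.eventually_all_finset I).2 key).and self_mem_nhdsWithin).exists
  have hε' : (0 : ℝ) < ε := hpos
  have hsplit : (b : V) = ∑ i ∈ I, (γ i + ε * β i) • (D.e i : V) + ε • D.ξ := by
    rw [hξ, hbγ, Finset.smul_sum, ← Finset.sum_add_distrib]
    refine Finset.sum_congr rfl fun i _ => ?_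
    rw [smul_smul, ← add_smul]
    congr 1
    ring
  change (b : V) ∈ interior (D.K : Set V)
  rw [hsplit]
  refine D.add_mem_interior (D.sum_mem I _ hε) ?_
  have hsub : (fun v : V => ε • v) '' interior (D.K : Set V) ⊆ interior (D.K : Set V) := by
    refine interior_maximal ?_ ((isOpenMap_smul₀ hε'.ne') _ isOpen_interior)
    rintro _ ⟨v, hv, rfl⟩
    exact D.K.smul_mem hε'.le (interior_subset hv)
  exact hsub ⟨D.ξ, D.ξ_mem, rfl⟩

section Quotients

variable {r : ℕ} (m : Module.Basis (Fin r) ℂ (N →ₗ[ℤ] ℂ)) (a : Fin D.d → ℂ)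

/-- The elements `Z_j = ∑_i ⟨m_j, e_i⟩ exp(2 π i a_i) x^{e_i}` of `R`, where `m` is a basis of
`Hom(N, ℂ) = Hom(N, ℤ) ⊗ ℂ`. -/
def Zelt (j : Fin r) : D.R :=
  ∑ i, (m j (D.e i) * Complex.exp (2 * Real.pi * Complex.I * a i)) • D.x ⟨D.e i, D.e_mem i⟩

/-- The ideal `Z` generated by the `Z_j`. -/
def Z : Ideal D.R := Ideal.span (Set.range (D.Zelt m a))

/-- `R / ZR`. -/
abbrev Q : Type _ := D.R ⧸ D.Z m a

/-- `R^{open} / Z R^{open}`. -/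
abbrev Qopen : Type _ := D.Ropen ⧸ (D.Z m a • ⊤ : Submodule D.R D.Ropen)

/-- The image of `x^n` in `R / ZR`. -/
def xQ (n : D.points) : D.Q m a := Submodule.Quotient.mk (D.x n)

/-- The image of `x^n` in `R^{open} / Z R^{open}`. -/
def xQopen (n : D.points) (hn : D.IsInner n) : D.Qopen m a :=
  Submodule.Quotient.mk (D.xopen n hn)

/-- The map `⊕_b ℂ[x^b] → R / ZR`, where `b` runs over the union of the `B_{I,ξ}`. -/
def spanMap : (D.B D.ξ →₀ ℂ) →ₗ[ℂ] D.Q m a :=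
  Finsupp.linearCombination ℂ fun b : D.B D.ξ => D.xQ m a ⟨b, D.mem_points_of_mem_B b.2⟩

/-- The map `⊕_b ℂ[x^b] → R^{open} / Z R^{open}`, where `b` runs over the union of the
`B_{I,-ξ}`. -/
def spanMapOpen : (D.B (-D.ξ) →₀ ℂ) →ₗ[ℂ] D.Qopen m a :=
  Finsupp.linearCombination ℂ fun b : D.B (-D.ξ) =>
    D.xQopen m a ⟨b, D.mem_points_of_mem_B b.2⟩ (D.isInner_of_mem_B b.2)

/-- The part of degree `k` of `R / ZR`. -/
def gradedPart (k : ℕ) : Submodule ℂ (D.Q m a) :=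
  Submodule.span ℂ {y | ∃ n : D.points, D.deg n = k ∧ y = D.xQ m a n}

/-- The part of degree `k` of `R^{open} / Z R^{open}`. -/
def gradedPartOpen (k : ℕ) : Submodule ℂ (D.Qopen m a) :=
  Submodule.span ℂ {y | ∃ (n : D.points) (hn : D.IsInner n), D.deg n = k ∧ y = D.xQopen m a n hn}

end Quotients

/-- `S(t) = (1 - t)^r ∑_{n ∈ K ∩ N} t^{deg n}`, where `r` is the rank of `N`. -/
def S : ℤ⟦X⟧ :=
  (1 - PowerSeries.X) ^ Module.finrank ℤ N *
    PowerSeries.mk fun k => (Nat.card {n : D.points // D.deg n = k} : ℤ)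

/-- `T(t) = (1 - t)^r ∑_{n ∈ K^{open} ∩ N} t^{deg n}`, where `r` is the rank of `N`. -/
def Topen : ℤ⟦X⟧ :=
  (1 - PowerSeries.X) ^ Module.finrank ℤ N *
    PowerSeries.mk fun k => (Nat.card {n : D.points // D.IsInner n ∧ D.deg n = k} : ℤ)

end GradedConeData

/-- The graded dimension `∑_k dim(A_k) t^k`. -/
def gradedDim {A : Type*} [AddCommGroup A] [Module ℂ A] (A' : ℕ → Submodule ℂ A) : ℤ⟦X⟧ :=
  PowerSeries.mk fun k => (Module.finrank ℂ (A' k) : ℤ)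

end

/-!
The monomials `x^b`, with `b` in the union of the boxes, span `R / ZR` for generic weights by a
degeneration, and they are linearly independent by a count of dimensions.

*Half-open decomposition.* Let `η` be `ξ` or `-ξ`. The lattice points from which one enters the
interior of `K` in the direction of `η` are those of `K` for `η = ξ` (`enters_ξ_iff`), and those of
its interior for `η = -ξ` (`enters_neg_ξ_iff`). A small step in the direction of `η` leads into the
open cone of exactly one simplex `I` of maximum dimension, so these points are the disjoint union of
the lattice points of half-open simplicial cones. Each of the latter is the union of the translates
of the box `B_{I,η}` by the monoid generated by the `e_i`, `i ∈ I`. This gives a bijection, adding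
up degrees, of `B_η × ℕ^r` with the points in question (`translateEquiv`).

*Spanning.* For `n` outside the boxes, `n = q + e_i` with `q` in the same half-open cone. If `μ` is
the coordinate of `e_i` in this cone, then the product of `∑_j ⟨μ, e_j⟩ y_j x^{e_j}` with `x^q`
involves `x^n` with coefficient `y_i`, and otherwise only `x^{q + e_j}` with `j ∉ I`. Let `ψ` be the
piecewise linear function of the regular triangulation, put `y_j = s^{ψ(e_j)}` and rescale `x^p` to
`s^{ψ(p)} x^p`. For `s → 0` there survive only the `x^{q + e_j}` for which `q` and `e_j` lie in a
common simplicial cone, and for those the linear form of `ψ` on the cone of `q + e_j` has a smaller value at `η` than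
that on the cone of `n` (`IsSupport.apply_lt`). So the matrix of these relations becomes
unitriangular in the limit, and its determinant is a nonzero polynomial in `y` in each degree
(`exists_row`, `exists_polynomial_degree`). Boxes have no points of degree above `r`, and therefore
finitely many degrees suffice (`exists_polynomial`).

*Independence.* If the `x^b` span modulo `Z`, their products with the monomials in
`Z_1, …, Z_r` span `R` or `R^{open}`. In every degree these are as many as the `x^n`, by the
bijection above; so they are linearly independent (`linearIndependent_monomialMul`), and the `x^b`
are linearly independent modulo `Z`. The graded dimensions follow from the same bijection
(`one_sub_X_pow_mul_mk_card`).
-/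

noncomputable section

open Filter Topology Module

namespace GradedConeData

variable {V : Type*} [NormedAddCommGroup V] [NormedSpace ℝ V] {N : Submodule ℤ V}
  (D : GradedConeData N)

/-! ### Coordinates on the simplices of maximum dimension -/

/-- The simplices of maximum dimension of the triangulation. -/
def maxCells : Finset (Finset (Fin D.d)) := D.T.filter fun I => I.card = finrank ℝ V

variable {D} in
lemma mem_maxCells {I : Finset (Fin D.d)} :
    I ∈ D.maxCells ↔ I ∈ D.T ∧ I.card = finrank ℝ V := by simp [maxCells]

lemma isTriangulation : IsTriangulation D.K (fun i => (D.e i : V)) D.T := D.regular.1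

variable {D} in
lemma mem_simplexCone {I : Finset (Fin D.d)} {v : V} :
    v ∈ simplexCone (fun i => (D.e i : V)) I ↔
      ∃ γ : Fin D.d → ℝ, (∀ i ∈ I, 0 ≤ γ i) ∧ v = ∑ i ∈ I, γ i • (D.e i : V) := by
  unfold simplexCone PointedCone.hull
  rw [Submodule.mem_span_image_finset_iff_exists_fun']
  constructor
  · rintro ⟨c, rfl⟩
    exact ⟨fun i => (c i : ℝ), fun i _ => (c i).2, rfl⟩
  · rintro ⟨γ, hγ, rfl⟩
    refine ⟨fun i => ⟨max (γ i) 0, le_max_right _ _⟩, Finset.sum_congr rfl fun i hi => ?_⟩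
    change max (γ i) 0 • (D.e i : V) = _
    rw [max_eq_left (hγ i hi)]

lemma simplexCone_le {I : Finset (Fin D.d)} {v : V}
    (hv : v ∈ simplexCone (fun i => (D.e i : V)) I) : v ∈ D.K := by
  obtain ⟨γ, hγ, rfl⟩ := mem_simplexCone.1 hv
  exact D.sum_mem I γ hγ

lemma e_ne_zero (i : Fin D.d) : D.e i ≠ 0 := by
  intro h
  have := D.deg_e i
  simp [h] at this

lemma smul_mem_interior {v : V} (hv : v ∈ interior (D.K : Set V)) {ε : ℝ} (hε : 0 < ε) :
    ε • v ∈ interior (D.K : Set V) := by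
  have hsub : (fun v : V => ε • v) '' interior (D.K : Set V) ⊆ interior (D.K : Set V) := by
    refine interior_maximal ?_ ((isOpenMap_smul₀ hε.ne') _ isOpen_interior)
    rintro _ ⟨v, hv, rfl⟩
    exact D.K.smul_mem hε.le (interior_subset hv)
  exact hsub ⟨v, hv, rfl⟩

/-- Moving from `v` in the direction of `η`, one immediately gets into the interior of `K`. For
`η = ξ` these are the points of `K`, for `η = -ξ` the points of its interior. -/
def Enters (η v : V) : Prop := ∀ᶠ ε : ℝ in 𝓝[>] 0, v + ε • η ∈ interior (D.K : Set V)

variable {D} in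
lemma Enters.add_mem {η u v : V} (hu : u ∈ D.K) (h : D.Enters η v) : D.Enters η (u + v) :=
  h.mono fun ε hε => by
    rw [add_assoc]
    exact D.add_mem_interior hu hε

variable {D} in
/-- A simplex contains no vertices but its own. -/
lemma e_notMem_simplexCone {I : Finset (Fin D.d)} (hI : I ∈ D.T) {j : Fin D.d}
    (hj : j ∉ I) : (D.e j : V) ∉ simplexCone (fun i => (D.e i : V)) I := by
  intro h
  have hjj : (D.e j : V) ∈ simplexCone (fun i => (D.e i : V)) {j} :=
    mem_simplexCone.2 ⟨fun _ => 1, fun _ _ => zero_le_one, by simp⟩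
  have : (D.e j : V) ∈ simplexCone (fun i => (D.e i : V)) (I ∩ {j}) := by
    rw [← D.isTriangulation.inter I hI {j} (D.maximum j)]
    exact ⟨h, hjj⟩
  rw [Finset.inter_singleton_of_notMem hj, mem_simplexCone] at this
  obtain ⟨γ, -, hγ⟩ := this
  exact D.e_ne_zero j (Subtype.ext (by simpa using hγ))

lemma enters_neg_ξ_iff {v : V} : D.Enters (-D.ξ) v ↔ v ∈ interior (D.K : Set V) := by
  constructor
  · intro h
    obtain ⟨ε, h1, h2⟩ := (h.and self_mem_nhdsWithin).exists
    have := D.add_mem_interior (interior_subset h1) (D.smul_mem_interior D.ξ_mem h2)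
    simpa using this
  · intro hv
    have ht : Tendsto (fun ε : ℝ => v + ε • (-D.ξ)) (𝓝[>] 0) (𝓝 (v + (0 : ℝ) • (-D.ξ))) :=
      (Continuous.tendsto (by fun_prop) 0).mono_left nhdsWithin_le_nhds
    exact ht.eventually (isOpen_interior.mem_nhds (by simpa using hv))

variable [FiniteDimensional ℝ V]

lemma exists_coord {I : Finset (Fin D.d)} (hI : I ∈ D.maxCells) :
    ∃ c : Fin D.d → V →ₗ[ℝ] ℝ,
      (∀ γ : Fin D.d → ℝ, ∀ i ∈ I, c i (∑ j ∈ I, γ j • (D.e j : V)) = γ i) ∧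
      (∀ v, ∑ i ∈ I, c i v • (D.e i : V) = v) := by
  classical
  obtain ⟨hIT, hcard⟩ := mem_maxCells.1 hI
  have hli := D.isTriangulation.linearIndependent I hIT
  let b : Basis I ℝ V := basisOfLinearIndependentOfCardEqFinrank' _ hli (by simpa using hcard)
  have hb : ∀ i : I, b i = (D.e i : V) := fun i => by simp [b]
  refine ⟨fun i => if h : i ∈ I then b.coord ⟨i, h⟩ else 0, fun γ i hi => ?_, fun v => ?_⟩
  · simp only [hi, dif_pos]
    rw [← Finset.sum_coe_sort I (fun j => γ j • (D.e j : V))]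
    simp_rw [← hb]
    simp [b.coord_apply, Finsupp.single_apply]
  · rw [← Finset.sum_coe_sort I]
    conv_rhs => rw [← b.sum_repr v]
    refine Finset.sum_congr rfl fun i _ => ?_
    simp [hb, b.coord_apply]

open Classical in
/-- The coordinates `v = ∑_{i ∈ I} coord I i v • e_i` with respect to a simplex `I` of maximum
dimension; zero if `I` is not such a simplex. -/
def coord (I : Finset (Fin D.d)) : Fin D.d → V →ₗ[ℝ] ℝ :=
  if h : I ∈ D.maxCells then (D.exists_coord h).choose else 0

variable {D} in
lemma coord_sum {I : Finset (Fin D.d)} (hI : I ∈ D.maxCells) (γ : Fin D.d → ℝ) {i : Fin D.d}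
    (hi : i ∈ I) : D.coord I i (∑ j ∈ I, γ j • (D.e j : V)) = γ i := by
  rw [coord, dif_pos hI]
  exact (D.exists_coord hI).choose_spec.1 γ i hi

variable {D} in
lemma sum_coord {I : Finset (Fin D.d)} (hI : I ∈ D.maxCells) (v : V) :
    ∑ i ∈ I, D.coord I i v • (D.e i : V) = v := by
  rw [coord, dif_pos hI]
  exact (D.exists_coord hI).choose_spec.2 v

variable {D} in
lemma coord_e {I : Finset (Fin D.d)} (hI : I ∈ D.maxCells) {i j : Fin D.d} (hi : i ∈ I)
    (hj : j ∈ I) : D.coord I i (D.e j) = if i = j then 1 else 0 := by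
  have := coord_sum hI (fun k => if k = j then 1 else 0) hi
  simpa [hj] using this

variable {D} in
lemma mem_simplexCone_iff_coord {I : Finset (Fin D.d)} (hI : I ∈ D.maxCells) {v : V} :
    v ∈ simplexCone (fun i => (D.e i : V)) I ↔ ∀ i ∈ I, 0 ≤ D.coord I i v := by
  rw [mem_simplexCone]
  constructor
  · rintro ⟨γ, hγ, rfl⟩ i hi
    rw [coord_sum hI γ hi]
    exact hγ i hi
  · exact fun h => ⟨fun i => D.coord I i v, h, (sum_coord hI v).symm⟩

/-- If all coordinates of a point with respect to one simplex of maximum dimension are positive,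
this is the only simplex of maximum dimension containing the point. -/
lemma eq_of_coord_pos {I J : Finset (Fin D.d)} (hI : I ∈ D.maxCells) (hJ : J ∈ D.maxCells) {v : V}
    (hv : ∀ i ∈ I, 0 < D.coord I i v) (hvJ : v ∈ simplexCone (fun i => (D.e i : V)) J) :
    I = J := by
  have hvI : v ∈ simplexCone (fun i => (D.e i : V)) I :=
    (mem_simplexCone_iff_coord hI).2 fun i hi => (hv i hi).le
  have : v ∈ simplexCone (fun i => (D.e i : V)) (I ∩ J) := by
    rw [← D.isTriangulation.inter I (mem_maxCells.1 hI).1 J (mem_maxCells.1 hJ).1]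
    exact ⟨hvI, hvJ⟩
  obtain ⟨γ, -, hγ⟩ := mem_simplexCone.1 this
  classical
  have hsub : I ⊆ J := by
    intro i hi
    by_contra hiJ
    have h1 : v = ∑ j ∈ I, (if j ∈ J then γ j else 0) • (D.e j : V) := by
      rw [hγ, ← Finset.filter_mem_eq_inter, Finset.sum_filter]
      refine Finset.sum_congr rfl fun j _ => ?_
      split_ifs <;> simp
    have h2 := hv i hi
    rw [h1, coord_sum hI _ hi] at h2
    simp [hiJ] at h2
  refine Finset.eq_of_subset_of_card_le hsub ?_
  rw [(mem_maxCells.1 hI).2, (mem_maxCells.1 hJ).2]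

lemma isClosed_simplexCone {I : Finset (Fin D.d)} (hI : I ∈ D.maxCells) :
    IsClosed (simplexCone (fun i => (D.e i : V)) I : Set V) := by
  have : (simplexCone (fun i => (D.e i : V)) I : Set V) =
      ⋂ i ∈ I, {v | 0 ≤ D.coord I i v} := by
    ext v
    simp [mem_simplexCone_iff_coord hI]
  rw [this]
  exact isClosed_biInter fun i _ =>
    isClosed_le continuous_const (LinearMap.continuous_of_finiteDimensional _)

variable {D} in
/-- The points with positive coordinates with respect to a simplex lie in the interior of `K`. -/
lemma mem_interior_of_coord_pos {I : Finset (Fin D.d)} (hI : I ∈ D.maxCells) {v : V}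
    (hv : ∀ i ∈ I, 0 < D.coord I i v) : v ∈ interior (D.K : Set V) := by
  rw [mem_interior]
  refine ⟨⋂ i ∈ I, {v | 0 < D.coord I i v}, fun w hw => ?_, ?_, by simpa using hv⟩
  · simp only [Set.mem_iInter, Set.mem_ofPred_eq] at hw
    exact D.simplexCone_le ((mem_simplexCone_iff_coord hI).2 fun i hi => (hw i hi).le)
  · exact isOpen_biInter_finset fun i _ =>
      isOpen_lt continuous_const (LinearMap.continuous_of_finiteDimensional _)

/-- The simplices of maximum dimension cover the interior of `K`: what they leave out is open and
contained in the union of finitely many proper subspaces. -/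
lemma exists_maxCell_of_mem_interior {v : V} (hv : v ∈ interior (D.K : Set V)) :
    ∃ I ∈ D.maxCells, v ∈ simplexCone (fun i => (D.e i : V)) I := by
  by_contra! hcon
  borelize V
  let μ : MeasureTheory.Measure V := MeasureTheory.Measure.addHaar
  let F : Set V := ⋃ I ∈ D.maxCells, (simplexCone (fun i => (D.e i : V)) I : Set V)
  have hF : IsClosed F := isClosed_biUnion_finset fun I hI => D.isClosed_simplexCone hI
  have hU : IsOpen (interior (D.K : Set V) ∩ Fᶜ) := isOpen_interior.inter hF.isOpen_compl
  have hne : (interior (D.K : Set V) ∩ Fᶜ).Nonempty := ⟨v, hv, by simpa [F] using hcon⟩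
  have hsub : interior (D.K : Set V) ∩ Fᶜ ⊆
      ⋃ I ∈ D.T.filter (fun I => I.card ≠ finrank ℝ V),
        (Submodule.span ℝ ((fun i => (D.e i : V)) '' (I : Set (Fin D.d))) : Set V) := by
    rintro w ⟨hwK, hwF⟩
    obtain ⟨I, hI, hw⟩ := (D.isTriangulation.cover w).1 (interior_subset hwK)
    have hcard : I.card ≠ finrank ℝ V := fun h =>
      hwF (Set.mem_biUnion (mem_maxCells.2 ⟨hI, h⟩) hw)
    refine Set.mem_biUnion (x := I) (by simpa using ⟨hI, hcard⟩) ?_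
    obtain ⟨γ, -, rfl⟩ := mem_simplexCone.1 hw
    exact Submodule.sum_mem _ fun i hi =>
      Submodule.smul_mem _ _ (Submodule.subset_span ⟨i, hi, rfl⟩)
  have hnull : μ (⋃ I ∈ D.T.filter (fun I => I.card ≠ finrank ℝ V),
      (Submodule.span ℝ ((fun i => (D.e i : V)) '' (I : Set (Fin D.d))) : Set V)) = 0 := by
    refine (MeasureTheory.measure_biUnion_null_iff (Finset.countable_toSet _)).2 fun I hI => ?_
    have hI' : I ∈ D.T ∧ I.card ≠ finrank ℝ V := by simpa using hI
    refine MeasureTheory.Measure.addHaar_submodule _ _ fun htop => hI'.2 ?_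
    have hli := D.isTriangulation.linearIndependent I hI'.1
    have := finrank_span_eq_card hli
    rw [show Set.range (fun i : I => (D.e i : V)) =
      (fun i => (D.e i : V)) '' (I : Set (Fin D.d)) by ext; simp, htop, finrank_top] at this
    simpa using this.symm
  exact (hU.measure_pos μ hne).ne' (MeasureTheory.measure_mono_null hsub hnull)

/-! ### The half-open decomposition in a generic direction -/

/-- The vector `η` has no vanishing coordinate with respect to any simplex of maximum
dimension. -/
def IsGeneric (η : V) : Prop := ∀ I ∈ D.maxCells, ∀ i ∈ I, D.coord I i η ≠ 0

/-- `v` lies in the half-open cone of the simplex `I`: the coordinates of `v` are nonnegative, and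
those where the coordinate of `η` is negative are positive. -/
def HalfOpen (η : V) (I : Finset (Fin D.d)) (v : V) : Prop :=
  ∀ i ∈ I, 0 ≤ D.coord I i v ∧ (D.coord I i η < 0 → 0 < D.coord I i v)

variable {D}

lemma HalfOpen.mem_simplexCone {η : V} {I : Finset (Fin D.d)} (hI : I ∈ D.maxCells) {v : V}
    (h : D.HalfOpen η I v) : v ∈ simplexCone (fun i => (D.e i : V)) I :=
  (mem_simplexCone_iff_coord hI).2 fun i hi => (h i hi).1

lemma HalfOpen.eventually_coord_pos {η : V} (hη : D.IsGeneric η) {I : Finset (Fin D.d)}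
    (hI : I ∈ D.maxCells) {v : V} (h : D.HalfOpen η I v) :
    ∀ᶠ ε : ℝ in 𝓝[>] 0, ∀ i ∈ I, 0 < D.coord I i (v + ε • η) := by
  rw [Filter.eventually_all_finset]
  intro i hi
  simp only [map_add, map_smul, smul_eq_mul]
  rcases lt_or_gt_of_ne (hη I hI i hi) with hneg | hpos
  · have ht : Tendsto (fun ε : ℝ => D.coord I i v + ε * D.coord I i η) (𝓝[>] 0)
        (𝓝 (D.coord I i v + 0 * D.coord I i η)) :=
      (Continuous.tendsto (by fun_prop) 0).mono_left nhdsWithin_le_nhds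
    exact ht.eventually (lt_mem_nhds (by simpa using (h i hi).2 hneg))
  · filter_upwards [self_mem_nhdsWithin] with ε hε
    have := (h i hi).1
    have := mul_pos (Set.mem_Ioi.1 hε) hpos
    linarith

lemma HalfOpen.enters {η : V} (hη : D.IsGeneric η) {I : Finset (Fin D.d)}
    (hI : I ∈ D.maxCells) {v : V} (h : D.HalfOpen η I v) : D.Enters η v :=
  (h.eventually_coord_pos hη hI).mono fun _ hε => mem_interior_of_coord_pos hI hε

lemma HalfOpen.unique {η : V} (hη : D.IsGeneric η) {I J : Finset (Fin D.d)}
    (hI : I ∈ D.maxCells) (hJ : J ∈ D.maxCells) {v : V} (h : D.HalfOpen η I v)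
    (h' : D.HalfOpen η J v) : I = J := by
  obtain ⟨ε, h1, h2⟩ :=
    ((h.eventually_coord_pos hη hI).and (h'.eventually_coord_pos hη hJ)).exists
  exact D.eq_of_coord_pos hI hJ h1
    ((mem_simplexCone_iff_coord hJ).2 fun i hi => (h2 i hi).le)

lemma Enters.exists_halfOpen {η v : V} (h : D.Enters η v) :
    ∃ I ∈ D.maxCells, D.HalfOpen η I v := by
  have h1 : ∃ᶠ ε : ℝ in 𝓝[>] 0, ∃ I ∈ D.maxCells,
      0 < ε ∧ v + ε • η ∈ simplexCone (fun i => (D.e i : V)) I := by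
    refine Eventually.frequently ?_
    filter_upwards [h, self_mem_nhdsWithin] with ε hε hpos
    obtain ⟨I, hI, hmem⟩ := D.exists_maxCell_of_mem_interior hε
    exact ⟨I, hI, hpos, hmem⟩
  obtain ⟨I, hI, hfr⟩ := (Finset.frequently_exists _).1 h1
  refine ⟨I, hI, fun i hi => ?_⟩
  have hfr' : ∃ᶠ ε : ℝ in 𝓝[>] 0, 0 < ε ∧ 0 ≤ D.coord I i v + ε * D.coord I i η :=
    hfr.mono fun ε ⟨hpos, hε⟩ => ⟨hpos, by
      simpa using (mem_simplexCone_iff_coord hI).1 hε i hi⟩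
  refine ⟨?_, fun hneg => ?_⟩
  · by_contra! hlt
    have ht : Tendsto (fun ε : ℝ => D.coord I i v + ε * D.coord I i η) (𝓝[>] 0)
        (𝓝 (D.coord I i v + 0 * D.coord I i η)) :=
      (Continuous.tendsto (by fun_prop) 0).mono_left nhdsWithin_le_nhds
    obtain ⟨ε, ⟨-, h1⟩, h2⟩ :=
      (hfr'.and_eventually (ht.eventually (gt_mem_nhds (by simpa using hlt)))).exists
    exact absurd h1 (not_le.2 h2)
  · obtain ⟨ε, hpos, h1⟩ := hfr'.exists
    have := mul_neg_of_pos_of_neg hpos hneg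
    linarith

lemma Enters.mem {η v : V} (h : D.Enters η v) : v ∈ D.K := by
  obtain ⟨I, hI, hv⟩ := h.exists_halfOpen
  exact D.simplexCone_le (hv.mem_simplexCone hI)

variable (D)

lemma enters_ξ_iff {v : V} : D.Enters D.ξ v ↔ v ∈ D.K := by
  refine ⟨Enters.mem, fun hv => ?_⟩
  filter_upwards [self_mem_nhdsWithin] with ε hε
  exact D.add_mem_interior hv (D.smul_mem_interior D.ξ_mem hε)

lemma isGeneric_ξ : D.IsGeneric D.ξ := fun I hI =>
  D.ξ_generic I (mem_maxCells.1 hI).1 (mem_maxCells.1 hI).2 _ (sum_coord hI _).symm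

variable {D} in
lemma IsGeneric.neg {η : V} (h : D.IsGeneric η) : D.IsGeneric (-η) := fun I hI i hi => by
  simpa using h I hI i hi

end GradedConeData

namespace GradedConeData

variable {V : Type*} [NormedAddCommGroup V] [NormedSpace ℝ V] {N : Submodule ℤ V}
  (D : GradedConeData N)

/-! ### Boxes -/

variable {D} in
lemma exists_cell_of_mem_B {η : V} {b : N} (hb : b ∈ D.B η) :
    ∃ I ∈ D.maxCells, b ∈ D.box I η := by
  obtain ⟨I, hI, hcard, hbox⟩ := hb
  have hI' := mem_maxCells.2 ⟨hI, hcard⟩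
  exact ⟨I, hI', hbox⟩

/-- The simplex of maximum dimension whose box contains `b`. -/
def cell {η : V} (b : D.B η) : Finset (Fin D.d) := (exists_cell_of_mem_B b.2).choose

lemma cell_mem {η : V} (b : D.B η) : D.cell b ∈ D.maxCells :=
  (exists_cell_of_mem_B b.2).choose_spec.1

lemma mem_box_cell {η : V} (b : D.B η) : (b : N) ∈ D.box (D.cell b) η :=
  (exists_cell_of_mem_B b.2).choose_spec.2

variable [FiniteDimensional ℝ V]

variable {D} in
lemma mem_box_iff {η : V} {I : Finset (Fin D.d)} (hI : I ∈ D.maxCells)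
    {b : N} : b ∈ D.box I η ↔ D.HalfOpen η I b ∧
      ∀ i ∈ I, (D.coord I i η < 0 → D.coord I i b ≤ 1) ∧
        (0 < D.coord I i η → D.coord I i b < 1) := by
  constructor
  · rintro ⟨β, γ, hβ, hγ, h⟩
    have hβ' : ∀ i ∈ I, D.coord I i η = β i := fun i hi => by rw [hβ, coord_sum hI _ hi]
    have hγ' : ∀ i ∈ I, D.coord I i b = γ i := fun i hi => by rw [hγ, coord_sum hI _ hi]
    refine ⟨fun i hi => ?_, fun i hi => ?_⟩
    · rw [hβ' i hi, hγ' i hi]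
      exact ⟨(h i hi).1, fun hneg => ((h i hi).2.1 hneg).1⟩
    · rw [hβ' i hi, hγ' i hi]
      exact ⟨fun hneg => ((h i hi).2.1 hneg).2, fun hpos => ((h i hi).2.2 hpos).2⟩
  · rintro ⟨h1, h2⟩
    refine ⟨fun i => D.coord I i η, fun i => D.coord I i b, (sum_coord hI _).symm,
      (sum_coord hI _).symm, fun i hi => ⟨(h1 i hi).1, fun hneg => ?_, fun hpos => ?_⟩⟩
    · exact ⟨(h1 i hi).2 hneg, (h2 i hi).1 hneg⟩
    · exact ⟨(h1 i hi).1, (h2 i hi).2 hpos⟩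

variable {D} in
/-- A lattice point of a half-open cone which is not in the box remains in the half-open cone
after subtracting some generator of the cone. -/
lemma HalfOpen.exists_sub {η : V} (hη : D.IsGeneric η) {I : Finset (Fin D.d)}
    (hI : I ∈ D.maxCells) {n : N} (h : D.HalfOpen η I n) (hn : n ∉ D.box I η) :
    ∃ i ∈ I, D.HalfOpen η I (n - D.e i : N) := by
  rw [mem_box_iff hI] at hn
  have : ∃ i ∈ I, (D.coord I i η < 0 → 1 < D.coord I i n) ∧
      (0 < D.coord I i η → 1 ≤ D.coord I i n) := by
    by_contra! hcon
    refine hn ⟨h, fun i hi => ?_⟩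
    rcases lt_or_gt_of_ne (hη I hI i hi) with hneg | hpos
    · refine ⟨fun _ => ?_, fun hp => absurd hneg hp.not_gt⟩
      by_contra! hlt
      exact absurd (hcon i hi fun _ => hlt).1 hneg.not_gt
    · refine ⟨fun hp => absurd hpos hp.not_gt, fun _ => ?_⟩
      by_contra! hle
      exact (hcon i hi fun hp => absurd hpos hp.not_gt).2.not_ge hle
  obtain ⟨i, hi, h1, h2⟩ := this
  refine ⟨i, hi, fun j hj => ?_⟩
  rw [Submodule.coe_sub, map_sub, coord_e hI hj hi]
  split_ifs with hji
  · subst hji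
    refine ⟨?_, fun hneg => by linarith [h1 hneg]⟩
    rcases lt_or_gt_of_ne (hη I hI j hj) with hneg | hpos
    · linarith [h1 hneg]
    · linarith [h2 hpos]
  · simpa using h j hj

lemma halfOpen_cell {η : V} (b : D.B η) : D.HalfOpen η (D.cell b) (b : N) :=
  (mem_box_iff (D.cell_mem b)).1 (D.mem_box_cell b) |>.1

/-- The point `e_i` of the monoid `K ∩ N`. -/
def ept (i : Fin D.d) : D.points := ⟨D.e i, D.e_mem i⟩

/-- The lattice points of `K` from which one enters the interior of `K` in the direction of
`η`. -/
abbrev Pts (η : V) : Type _ := {n : D.points // D.Enters η ((n : N) : V)}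

/-- A point of a box as one of the points from which one enters `K` in the direction of `η`. -/
def bpt {η : V} (hη : D.IsGeneric η) (b : D.B η) : D.Pts η :=
  ⟨⟨b, D.mem_points_of_mem_B b.2⟩, by
    exact (D.halfOpen_cell b).enters hη (D.cell_mem b)⟩

lemma bpt_injective {η : V} (hη : D.IsGeneric η) : Function.Injective (D.bpt hη) := fun b b' h => by
  exact Subtype.ext (congrArg (fun p : D.Pts η => (p.1 : N)) h)

variable {D} in
/-- A lattice point outside the boxes is obtained from another one by adding a vertex of the
simplex whose half-open cone contains both. -/
lemma Pts.exists_eq_add {η : V} (hη : D.IsGeneric η) (n : D.Pts η) (hn : (n.1 : N) ∉ D.B η) :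
    ∃ I ∈ D.maxCells, ∃ i ∈ I, ∃ q : D.Pts η, n.1 = q.1 + D.ept i ∧
      D.HalfOpen η I (n.1 : N) ∧ D.HalfOpen η I (q.1 : N) := by
  obtain ⟨I, hI, h⟩ := n.2.exists_halfOpen
  have hbox : (n.1 : N) ∉ D.box I η := fun hbox =>
    hn ⟨I, (mem_maxCells.1 hI).1, (mem_maxCells.1 hI).2, hbox⟩
  obtain ⟨i, hi, h'⟩ := h.exists_sub hη hI hbox
  refine ⟨I, hI, i, hi, ⟨⟨n.1 - D.e i, (h'.enters hη hI).mem⟩, h'.enters hη hI⟩, ?_, h, h'⟩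
  exact Subtype.ext (by simp [ept])

/-! ### Degrees -/

variable [DiscreteTopology N]

lemma finite_norm_le (C : ℝ) : {n : N | ‖(n : V)‖ ≤ C}.Finite := by
  have hcl : IsClosed (N : Set V) := by
    have : DiscreteTopology N.toAddSubgroup := ‹_›
    exact AddSubgroup.isClosed_of_discrete (H := N.toAddSubgroup)
  have hd : IsDiscrete (N : Set V) := ⟨‹_›⟩
  have := Metric.finite_isBounded_inter_isClosed hd
    (Metric.isBounded_closedBall (x := (0 : V)) (r := C)) hcl
  refine Set.Finite.of_finite_image (f := fun n : N => (n : V)) (this.subset ?_)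
    Subtype.val_injective.injOn
  rintro _ ⟨n, hn, rfl⟩
  exact ⟨by simpa using hn, n.2⟩

variable [IsZLattice ℝ N]

variable (N) in
/-- A linear form on the lattice extends to the vector space. -/
lemma exists_extension (f : N →ₗ[ℤ] ℤ) : ∃ F : V →ₗ[ℝ] ℝ, ∀ n : N, F n = f n := by
  have : Module.Finite ℤ N := ZLattice.module_finite ℝ N
  have : Module.Free ℤ N := ZLattice.module_free ℝ N
  let b := Module.Free.chooseBasis ℤ N
  let F : V →ₗ[ℝ] ℝ := (b.ofZLatticeBasis ℝ N).constr ℝ fun i => (f (b i) : ℝ)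
  refine ⟨F, fun n => ?_⟩
  have : (F.restrictScalars ℤ).comp N.subtype = (Algebra.linearMap ℤ ℝ).comp f := by
    refine b.ext fun i => ?_
    have h1 := (b.ofZLatticeBasis ℝ N).constr_basis ℝ (fun i => (f (b i) : ℝ)) i
    rw [Module.Basis.ofZLatticeBasis_apply] at h1
    simpa [F] using h1
  simpa using LinearMap.congr_fun this n

lemma deg_eq_sum {I : Finset (Fin D.d)} {n : N} {γ : Fin D.d → ℝ}
    (h : (n : V) = ∑ i ∈ I, γ i • (D.e i : V)) : (D.deg n : ℝ) = ∑ i ∈ I, γ i := by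
  obtain ⟨F, hF⟩ := exists_extension N D.deg
  rw [← hF, h, map_sum]
  refine Finset.sum_congr rfl fun i _ => ?_
  rw [map_smul, hF, D.deg_e]
  simp

lemma deg_eq_sum_coord {I : Finset (Fin D.d)} (hI : I ∈ D.maxCells) (n : N) :
    (D.deg n : ℝ) = ∑ i ∈ I, D.coord I i n :=
  D.deg_eq_sum (sum_coord hI _).symm

lemma deg_nonneg (n : D.points) : 0 ≤ D.deg n := by
  obtain ⟨γ, hγ, hn⟩ : ∃ γ : Fin D.d → ℝ, (∀ i ∈ Finset.univ, 0 ≤ γ i) ∧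
      ((n : N) : V) = ∑ i, γ i • (D.e i : V) := by
    obtain ⟨I, hI, hn⟩ := (D.isTriangulation.cover _).1 n.2
    refine mem_simplexCone.1 (Submodule.span_mono ?_ hn)
    exact Set.image_mono (by simp)
  have := D.deg_eq_sum hn
  have h0 : (0 : ℝ) ≤ D.deg n := this ▸ Finset.sum_nonneg hγ
  exact_mod_cast h0

/-- The degree of a lattice point of `K` as a natural number. -/
def ndeg (n : D.points) : ℕ := (D.deg n).toNat

lemma coe_ndeg (n : D.points) : (D.ndeg n : ℤ) = D.deg n := Int.toNat_of_nonneg (D.deg_nonneg n)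

lemma ndeg_eq_iff {n : D.points} {k : ℕ} : D.ndeg n = k ↔ D.deg n = k := by
  rw [← coe_ndeg, Nat.cast_inj]

lemma ndeg_add (n n' : D.points) : D.ndeg (n + n') = D.ndeg n + D.ndeg n' := by
  have h : ((D.ndeg (n + n') : ℕ) : ℤ) = D.ndeg n + D.ndeg n' := by
    simp only [coe_ndeg, AddSubmonoid.coe_add, map_add]
  exact_mod_cast h

lemma ndeg_ept (i : Fin D.d) : D.ndeg (D.ept i) = 1 := by
  rw [ndeg_eq_iff]
  exact D.deg_e i

lemma finite_ndeg_le (k : ℕ) : {n : D.points | D.ndeg n ≤ k}.Finite := by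
  refine Set.Finite.of_finite_image (f := fun n : D.points => (n : N))
    ((finite_norm_le (N := N) (k * ∑ i, ‖(D.e i : V)‖)).subset ?_) Subtype.val_injective.injOn
  rintro _ ⟨n, hn, rfl⟩
  obtain ⟨I, hI, h⟩ : ∃ I ∈ D.maxCells, D.HalfOpen D.ξ I (n : N) :=
    ((D.enters_ξ_iff).2 n.2).exists_halfOpen
  have hdeg := D.deg_eq_sum_coord hI n
  have hle : (D.deg n : ℝ) ≤ k := by
    rw [← coe_ndeg]; exact_mod_cast hn
  calc ‖((n : N) : V)‖ = ‖∑ i ∈ I, D.coord I i n • (D.e i : V)‖ := by rw [sum_coord hI]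
    _ ≤ ∑ i ∈ I, ‖D.coord I i n • (D.e i : V)‖ := norm_sum_le _ _
    _ ≤ ∑ i ∈ I, D.coord I i n * ∑ j, ‖(D.e j : V)‖ := by
        refine Finset.sum_le_sum fun i hi => ?_
        rw [norm_smul, Real.norm_of_nonneg (h i hi).1]
        exact mul_le_mul_of_nonneg_left
          (Finset.single_le_sum (f := fun j => ‖(D.e j : V)‖) (fun _ _ => norm_nonneg _)
            (Finset.mem_univ i)) (h i hi).1
    _ = D.deg n * ∑ j, ‖(D.e j : V)‖ := by rw [← Finset.sum_mul, hdeg]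
    _ ≤ _ := mul_le_mul_of_nonneg_right hle (Finset.sum_nonneg fun _ _ => norm_nonneg _)

/-! ### Lattice points and boxes -/

variable {η : V} (hη : D.IsGeneric η)

lemma card_cell (b : D.B η) : (D.cell b).card = finrank ℤ N := by
  rw [ZLattice.rank ℝ N]
  exact (mem_maxCells.1 (D.cell_mem b)).2

/-- The vertices of the simplex whose box contains `b`. -/
def vertex (b : D.B η) : Fin (finrank ℤ N) ↪o Fin D.d :=
  (D.cell b).orderEmbOfFin (D.card_cell b)

lemma vertex_mem (b : D.B η) (j : Fin (finrank ℤ N)) : D.vertex b j ∈ D.cell b :=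
  Finset.orderEmbOfFin_mem _ _ _

lemma exists_vertex_eq (b : D.B η) {i : Fin D.d} (hi : i ∈ D.cell b) :
    ∃ j, D.vertex b j = i := by
  have : i ∈ Set.range ((D.cell b).orderEmbOfFin (D.card_cell b)) := by
    rw [Finset.range_orderEmbOfFin]; exact hi
  exact this

/-- The lattice point `b + ∑_j α_j e_{i_j}`, where the `i_j` are the vertices of the simplex whose
box contains `b`. -/
def translate (b : D.B η) (α : Fin (finrank ℤ N) →₀ ℕ) : D.points :=
  (D.bpt hη b).1 + ∑ j, α j • D.ept (D.vertex b j)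

lemma coe_translate (b : D.B η) (α : Fin (finrank ℤ N) →₀ ℕ) :
    ((D.translate hη b α : N) : V) =
      (b : N) + ∑ j, (α j : ℝ) • (D.e (D.vertex b j) : V) := by
  simp [translate, bpt, ept, Nat.cast_smul_eq_nsmul]

lemma coord_translate (b : D.B η) (α : Fin (finrank ℤ N) →₀ ℕ) (j : Fin (finrank ℤ N)) :
    D.coord (D.cell b) (D.vertex b j) (D.translate hη b α : N) =
      D.coord (D.cell b) (D.vertex b j) (b : N) + α j := by
  simp [coe_translate, coord_e (D.cell_mem b) (D.vertex_mem b _) (D.vertex_mem b _)]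

lemma halfOpen_translate (b : D.B η) (α : Fin (finrank ℤ N) →₀ ℕ) :
    D.HalfOpen η (D.cell b) (D.translate hη b α : N) := by
  intro i hi
  obtain ⟨j, rfl⟩ := D.exists_vertex_eq b hi
  have h := D.halfOpen_cell b _ hi
  rw [coord_translate]
  have : (0 : ℝ) ≤ α j := Nat.cast_nonneg _
  exact ⟨by linarith, fun hneg => by linarith [h.2 hneg]⟩

lemma ndeg_translate (b : D.B η) (α : Fin (finrank ℤ N) →₀ ℕ) :
    D.ndeg (D.translate hη b α) = D.ndeg (D.bpt hη b).1 + α.degree := by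
  have hsum : ∀ (s : Finset (Fin (finrank ℤ N))),
      D.ndeg (∑ j ∈ s, α j • D.ept (D.vertex b j)) = ∑ j ∈ s, α j := by
    intro s
    have h : ((D.ndeg (∑ j ∈ s, α j • D.ept (D.vertex b j)) : ℕ) : ℤ) = (∑ j ∈ s, α j : ℕ) := by
      rw [coe_ndeg]
      simp [ept, D.deg_e]
    exact_mod_cast h
  rw [translate, ndeg_add, hsum, Finsupp.degree_eq_sum]

lemma translate_injective :
    Function.Injective fun p : D.B η × (Fin (finrank ℤ N) →₀ ℕ) => D.translate hη p.1 p.2 := by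
  rintro ⟨b, α⟩ ⟨b', α'⟩ h
  simp only at h
  have hcell : D.cell b = D.cell b' := by
    refine (D.halfOpen_translate hη b α).unique hη (D.cell_mem b) (D.cell_mem b') ?_
    rw [h]
    exact D.halfOpen_translate hη b' α'
  have hvert : D.vertex b = D.vertex b' := by
    simp only [vertex, hcell]
  have hα : α = α' := by
    ext j
    have h1 := D.coord_translate hη b α j
    have h2 := D.coord_translate hη b' α' j
    rw [← h, ← hcell, ← hvert] at h2
    have hI := D.cell_mem b
    have hi := D.vertex_mem b j
    have hb := ((mem_box_iff hI).1 (D.mem_box_cell b))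
    have hb' := ((mem_box_iff (D.cell_mem b')).1 (D.mem_box_cell b'))
    rw [← hcell] at hb'
    have a1 := hb.1 _ hi
    have a2 := hb.2 _ hi
    have a3 := hb'.1 _ hi
    have a4 := hb'.2 _ hi
    -- the coordinates of `b` and `b'` lie both in `(0, 1]` or both in `[0, 1)`
    have key : |(α j : ℝ) - α' j| < 1 := by
      rw [abs_lt]
      rcases lt_or_gt_of_ne (hη _ hI _ hi) with hneg | hpos
      · have := a1.2 hneg; have := a2.1 hneg; have := a3.2 hneg; have := a4.1 hneg
        constructor <;> linarith
      · have := a1.1; have := a2.2 hpos; have := a3.1; have := a4.2 hpos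
        constructor <;> linarith
    have : |(α j : ℤ) - α' j| < 1 := by exact_mod_cast key
    rw [Int.abs_lt_one_iff] at this
    omega
  subst hα
  have hb : b = b' := by
    have h1 := congrArg (fun n : D.points => ((n : N) : V)) h
    simp only [coe_translate, hvert] at h1
    exact Subtype.ext (Subtype.ext (add_right_cancel h1))
  rw [hb]

lemma exists_translate_eq (n : D.Pts η) : ∃ b α, D.translate hη b α = n.1 := by
  induction hk : D.ndeg n.1 using Nat.strong_induction_on generalizing n with
  | _ k ih =>
    by_cases hB : (n.1 : N) ∈ D.B η
    · exact ⟨⟨n.1, hB⟩, 0, by simp [translate, bpt]⟩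
    obtain ⟨I, hI, i, hi, q, hq, -, hqI⟩ := n.exists_eq_add hη hB
    have hlt : D.ndeg q.1 < k := by
      rw [← hk, hq, ndeg_add, ndeg_ept]
      exact Nat.lt_succ_self _
    obtain ⟨b, α, hbα⟩ := ih _ hlt q rfl
    have hcell : D.cell b = I := by
      refine HalfOpen.unique hη (D.cell_mem b) hI (D.halfOpen_translate hη b α) ?_
      rwa [hbα]
    obtain ⟨j, rfl⟩ := D.exists_vertex_eq b (hcell ▸ hi)
    refine ⟨b, α + Finsupp.single j 1, ?_⟩
    rw [hq, ← hbα]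
    have hsum : ∑ k, (Finsupp.single j 1 : Fin (finrank ℤ N) →₀ ℕ) k • D.ept (D.vertex b k) =
        D.ept (D.vertex b j) := by
      rw [Finset.sum_eq_single j (fun k _ hk => by simp [hk.symm]) (by simp)]
      simp
    simp only [translate, Finsupp.add_apply, add_smul, Finset.sum_add_distrib, hsum, add_assoc]

/-- The points in the half-open cones are the translates of the points in the boxes by
nonnegative integral combinations of the vertices of the respective simplices. -/
def translateEquiv : D.B η × (Fin (finrank ℤ N) →₀ ℕ) ≃ D.Pts η :=
  Equiv.ofBijective
    (fun p => ⟨D.translate hη p.1 p.2,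
      (D.halfOpen_translate hη p.1 p.2).enters hη (D.cell_mem p.1)⟩)
    ⟨fun _ _ h => D.translate_injective hη (congrArg Subtype.val h), fun n => by
      obtain ⟨b, α, h⟩ := D.exists_translate_eq hη n
      exact ⟨(b, α), Subtype.ext h⟩⟩

lemma ndeg_translateEquiv (p : D.B η × (Fin (finrank ℤ N) →₀ ℕ)) :
    D.ndeg (D.translateEquiv hη p).1 = D.ndeg (D.bpt hη p.1).1 + p.2.degree :=
  D.ndeg_translate hη p.1 p.2

lemma ndeg_bpt_le (b : D.B η) : D.ndeg (D.bpt hη b).1 ≤ finrank ℤ N := by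
  have hI := D.cell_mem b
  have h := (mem_box_iff hI).1 (D.mem_box_cell b)
  have h1 : (D.deg (b : N) : ℝ) ≤ finrank ℤ N := by
    rw [D.deg_eq_sum_coord hI, ← D.card_cell b, Finset.cast_card]
    refine Finset.sum_le_sum fun i hi => ?_
    rcases lt_or_gt_of_ne (hη _ hI i hi) with hneg | hpos
    · exact (h.2 i hi).1 hneg
    · exact ((h.2 i hi).2 hpos).le
  have h2 : ((D.ndeg (D.bpt hη b).1 : ℕ) : ℤ) ≤ finrank ℤ N := by
    rw [coe_ndeg]
    exact_mod_cast h1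
  exact_mod_cast h2

lemma finite_B {η : V} (hη : D.IsGeneric η) : Finite (D.B η) := by
  have := (D.finite_ndeg_le (finrank ℤ N)).to_subtype
  refine Finite.of_injective
    (β := {n : D.points | D.ndeg n ≤ finrank ℤ N})
    (fun b => ⟨(D.bpt hη b).1, D.ndeg_bpt_le hη b⟩) fun b b' h => ?_
  have h' : (D.bpt hη b).1 = (D.bpt hη b').1 := by
    have := congrArg Subtype.val h
    exact this
  exact D.bpt_injective hη (Subtype.ext h')

end GradedConeData

/-! ### A degeneration criterion for determinants -/

/-- A matrix with `1` on the diagonal, all of whose other nonzero entries lower a rank function, has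
determinant `1`. -/
lemma Matrix.det_eq_one_of_rank_lt {ι 𝕜 : Type*} [Fintype ι] [DecidableEq ι] [CommRing 𝕜]
    (L : Matrix ι ι 𝕜) (rank : ι → ℝ) (hdiag : ∀ n, L n n = 1)
    (hlt : ∀ n p, L n p ≠ 0 → p ≠ n → rank p < rank n) : L.det = 1 := by
  have htri : L.BlockTriangular (OrderDual.toDual ∘ rank) := by
    intro n p h
    by_contra hne
    have h' : rank n < rank p := h
    exact h'.not_gt (hlt n p hne (by rintro rfl; exact lt_irrefl _ h'))
  rw [htri.det]
  refine Finset.prod_eq_one fun a _ => ?_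
  have : L.toSquareBlock (OrderDual.toDual ∘ rank) a = 1 := by
    ext ⟨n, hn⟩ ⟨p, hp⟩
    rw [Matrix.toSquareBlock_def, Matrix.of_apply]
    rcases eq_or_ne n p with rfl | hne
    · simp [hdiag]
    · rw [Matrix.one_apply_ne (by simpa using hne)]
      by_contra h0
      refine (hlt n p h0 hne.symm).ne ?_
      exact OrderDual.toDual.injective (hp.trans hn.symm)
  rw [this, Matrix.det_one]

/-- A matrix of polynomials has nonzero determinant if its values along some family of points,
suitably rescaled, tend to an invertible matrix. -/
lemma Matrix.det_ne_zero_of_tendsto {ι σ α : Type*} [Fintype ι] [DecidableEq ι]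
    (W : Matrix ι ι (MvPolynomial σ ℂ)) {f : Filter α} [f.NeBot] (y : α → σ → ℂ) (u v : ι → α → ℂ)
    (L : Matrix ι ι ℂ) (hL : L.det ≠ 0)
    (h : ∀ n p, Tendsto (fun s => u n s * MvPolynomial.eval (y s) (W n p) * v p s) f
      (𝓝 (L n p))) : W.det ≠ 0 := by
  intro h0
  have hlim : Tendsto (fun s => (Matrix.of fun n p =>
      u n s * MvPolynomial.eval (y s) (W n p) * v p s).det) f (𝓝 L.det) :=
    (Continuous.matrix_det continuous_id).continuousAt.tendsto.comp
      (tendsto_pi_nhds.2 fun n => tendsto_pi_nhds.2 fun p => h n p)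
  have hzero : ∀ s, (Matrix.of fun n p =>
      u n s * MvPolynomial.eval (y s) (W n p) * v p s).det = 0 := by
    intro s
    have : (Matrix.of fun n p => u n s * MvPolynomial.eval (y s) (W n p) * v p s) =
        Matrix.diagonal (fun n => u n s) * W.map (MvPolynomial.eval (y s)) *
          Matrix.diagonal (fun p => v p s) := by
      ext n p
      simp [Matrix.mul_diagonal, Matrix.diagonal_mul]
    have h1 : (W.map (MvPolynomial.eval (y s))).det = 0 := by
      rw [← RingHom.mapMatrix_apply, ← RingHom.map_det, h0, map_zero]
    rw [this, Matrix.det_mul, Matrix.det_mul, h1]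
    simp
  exact hL (tendsto_nhds_unique hlim (by simpa only [hzero] using tendsto_const_nhds))

/-- If the determinant of `W` does not vanish, the vectors `x_p` are combinations of the vectors
`∑_p W_{n,p} x_p`. -/
lemma Matrix.mem_of_sum_smul_mem {ι E : Type*} [Fintype ι] [DecidableEq ι] [AddCommGroup E]
    [Module ℂ E] (W : Matrix ι ι ℂ) (hW : W.det ≠ 0) (x : ι → E) (S : Submodule ℂ E)
    (h : ∀ n, ∑ p, W n p • x p ∈ S) (p : ι) : x p ∈ S := by
  have h1 : W⁻¹ * W = 1 := Matrix.nonsing_inv_mul W (isUnit_iff_ne_zero.2 hW)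
  have h2 : x p = ∑ n, W⁻¹ p n • ∑ q, W n q • x q := by
    simp_rw [Finset.smul_sum, smul_smul]
    rw [Finset.sum_comm]
    simp_rw [← Finset.sum_smul, ← Matrix.mul_apply, h1, Matrix.one_apply]
    simp
  rw [h2]
  exact S.sum_mem fun n _ => S.smul_mem _ (h n)

lemma tendsto_ofReal_rpow {c : ℝ} (hc : 0 ≤ c) :
    Tendsto (fun s : ℝ => ((s ^ c : ℝ) : ℂ)) (𝓝[>] 0) (𝓝 (if c = 0 then 1 else 0)) := by
  have h1 : Tendsto (fun s : ℝ => s ^ c) (𝓝[>] 0) (𝓝 ((0 : ℝ) ^ c)) :=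
    (Real.continuousAt_rpow_const 0 c (Or.inr hc)).tendsto.mono_left nhdsWithin_le_nhds
  have h2 := (Complex.continuous_ofReal.tendsto _).comp h1
  have h3 : (if c = 0 then 1 else 0 : ℂ) = (((0 : ℝ) ^ c : ℝ) : ℂ) := by
    split_ifs with h
    · simp [h]
    · simp [Real.zero_rpow h]
  rw [h3]
  exact h2

namespace GradedConeData

variable {V : Type*} [NormedAddCommGroup V] [NormedSpace ℝ V] {N : Submodule ℤ V}
  (D : GradedConeData N)

/-! ### The piecewise linear function of a regular triangulation -/

/-- `ψ` agrees with the linear form `l I` on the cone of every simplex `I` of maximum dimension, and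
is strictly above it elsewhere on `K`. -/
structure IsSupport (ψ : V → ℝ) (l : Finset (Fin D.d) → V →ₗ[ℝ] ℝ) : Prop where
  eq : ∀ I ∈ D.maxCells, ∀ v ∈ simplexCone (fun i => (D.e i : V)) I, ψ v = l I v
  lt : ∀ I ∈ D.maxCells, ∀ v ∈ D.K, v ∉ simplexCone (fun i => (D.e i : V)) I → l I v < ψ v

lemma exists_isSupport : ∃ ψ l, D.IsSupport ψ l := by
  obtain ⟨-, ψ, -, hψ⟩ := D.regular
  have : ∀ I, ∃ l : V →ₗ[ℝ] ℝ, I ∈ D.maxCells →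
      (∀ v ∈ simplexCone (fun i => (D.e i : V)) I, ψ v = l v) ∧
      (∀ v ∈ D.K, v ∉ simplexCone (fun i => (D.e i : V)) I → l v < ψ v) := by
    intro I
    by_cases hI : I ∈ D.maxCells
    · obtain ⟨l, hl⟩ := hψ I (mem_maxCells.1 hI).1 (mem_maxCells.1 hI).2
      exact ⟨l, fun _ => hl⟩
    · exact ⟨0, fun h => absurd h hI⟩
  choose l hl using this
  exact ⟨ψ, l, fun I hI => (hl I hI).1, fun I hI => (hl I hI).2⟩

variable {D}

namespace IsSupport

variable {ψ : V → ℝ} {l : Finset (Fin D.d) → V →ₗ[ℝ] ℝ}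

lemma le (h : D.IsSupport ψ l) {I : Finset (Fin D.d)} (hI : I ∈ D.maxCells) {v : V}
    (hv : v ∈ D.K) : l I v ≤ ψ v := by
  by_cases hvI : v ∈ simplexCone (fun i => (D.e i : V)) I
  · exact (h.eq I hI v hvI).ge
  · exact (h.lt I hI v hv hvI).le

lemma add_le (h : D.IsSupport ψ l) {I : Finset (Fin D.d)} (hI : I ∈ D.maxCells) {u v : V}
    (hu : u ∈ D.K) (hv : v ∈ D.K)
    (huv : u + v ∈ simplexCone (fun i => (D.e i : V)) I) : ψ (u + v) ≤ ψ u + ψ v := by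
  rw [h.eq I hI _ huv, map_add]
  exact add_le_add (h.le hI hu) (h.le hI hv)

/-- The function is additive only on pairs of points of a common simplicial cone. -/
lemma mem_of_add_eq (h : D.IsSupport ψ l) {I : Finset (Fin D.d)} (hI : I ∈ D.maxCells) {u v : V}
    (hu : u ∈ D.K) (hv : v ∈ D.K) (huv : u + v ∈ simplexCone (fun i => (D.e i : V)) I)
    (heq : ψ u + ψ v = ψ (u + v)) : u ∈ simplexCone (fun i => (D.e i : V)) I ∧
      v ∈ simplexCone (fun i => (D.e i : V)) I := by
  rw [h.eq I hI _ huv, map_add] at heq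
  have h1 := h.le hI hu
  have h2 := h.le hI hv
  constructor
  · by_contra hcon
    have := h.lt I hI u hu hcon
    linarith
  · by_contra hcon
    have := h.lt I hI v hv hcon
    linarith

variable [FiniteDimensional ℝ V]

/-- The value `l I η` decreases when a vertex `e_j` outside `I` is added to a point `q` of the
half-open cone of `I`, provided that `q` and `e_j` lie in a common simplicial cone. Indeed, the
linear form of the new simplex coincides with `l I` at `q`, but is smaller than `l I` at the points
`q + ε • η`, which lie in the interior of the cone of `I`. -/
lemma apply_lt (h : D.IsSupport ψ l) {η : V} (hη : D.IsGeneric η) {I J : Finset (Fin D.d)}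
    (hI : I ∈ D.maxCells) (hJ : J ∈ D.maxCells) {q : V} (hq : D.HalfOpen η I q)
    {j : Fin D.d} (hj : j ∉ I)
    (hqJ : D.HalfOpen η J (q + D.e j)) (heq : ψ q + ψ (D.e j) = ψ (q + D.e j)) :
    l J η < l I η := by
  have hqI := hq.mem_simplexCone hI
  obtain ⟨hq', hj'⟩ := h.mem_of_add_eq hJ (D.simplexCone_le hqI) (D.e_mem j)
    (hqJ.mem_simplexCone hJ) heq
  obtain ⟨ε, hpos, hε⟩ := ((hq.eventually_coord_pos hη hI).and self_mem_nhdsWithin).exists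
  have hε : 0 < ε := hε
  have hmem : q + ε • η ∈ simplexCone (fun i => (D.e i : V)) I :=
    (mem_simplexCone_iff_coord hI).2 fun i hi => (hpos i hi).le
  have hnot : q + ε • η ∉ simplexCone (fun i => (D.e i : V)) J := by
    intro hcon
    obtain rfl := D.eq_of_coord_pos hI hJ hpos hcon
    exact e_notMem_simplexCone (mem_maxCells.1 hI).1 hj hj'
  have h1 := h.lt J hJ _ (D.simplexCone_le hmem) hnot
  rw [h.eq I hI _ hmem, map_add, map_add, map_smul, map_smul, ← h.eq I hI q hqI,
    ← h.eq J hJ q hq'] at h1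
  have h2 : ε * l J η < ε * l I η := by simpa using h1
  exact lt_of_mul_lt_mul_left h2 hε.le

end IsSupport

/-! ### The generic determinant -/

variable (D)

/-- The element `∑_i ⟨μ, e_i⟩ y_i x^{e_i}` of `R` given by a linear form `μ` and weights `y`. -/
def Zlin (y : Fin D.d → ℂ) (μ : N →ₗ[ℤ] ℂ) : D.R := ∑ i, (μ (D.e i) * y i) • D.x (D.ept i)

lemma x_add (n n' : D.points) : D.x (n + n') = D.x n * D.x n' := by
  simp [x, AddMonoidAlgebra.single_mul_single]

lemma Zlin_mul_x (y : Fin D.d → ℂ) (μ : N →ₗ[ℤ] ℂ) (q : D.points) :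
    D.Zlin y μ * D.x q = ∑ i, (μ (D.e i) * y i) • D.x (q + D.ept i) := by
  rw [Zlin, Finset.sum_mul]
  refine Finset.sum_congr rfl fun i _ => ?_
  rw [smul_mul_assoc, ← x_add, add_comm]

variable [FiniteDimensional ℝ V] [DiscreteTopology N] [IsZLattice ℝ N] {η : V}

/-- The elements of degree `k` of `Z · J`, where `J` is the span of the monomials in `Pts η`, and
`Z` is the ideal of the elements `Zlin y μ` with the given weights `y`. -/
def ZPart (η : V) (y : Fin D.d → ℂ) (k : ℕ) : Submodule ℂ D.R :=
  Submodule.span ℂ {f | ∃ (μ : N →ₗ[ℤ] ℂ) (q : D.Pts η), D.ndeg q.1 + 1 = k ∧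
    f = D.Zlin y μ * D.x q.1}

/-- The span of the `x^b` of degree `k`, where `b` runs over the points of the boxes. -/
def boxPart (hη : D.IsGeneric η) (k : ℕ) : Submodule ℂ D.R :=
  Submodule.span ℂ {f | ∃ b : D.B η, D.ndeg (D.bpt hη b).1 = k ∧ f = D.x (D.bpt hη b).1}

/-- The rows of the generic matrix. For `n` in a box the row is that of `x^n`. Otherwise
`n = q + e_i` in a half-open cone, and the row is that of `Z_μ x^q`, where `μ` is the coordinate of
`e_i`. With the weights `y_j = s ^ ψ(e_j)` and after rescaling `x^p` to `s ^ ψ(p) x^p`, the row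
becomes unitriangular for `s → 0`. -/
lemma exists_row (hη : D.IsGeneric η) {ψ : V → ℝ} {l : Finset (Fin D.d) → V →ₗ[ℝ] ℝ}
    (h : D.IsSupport ψ l) (c : D.Pts η → Finset (Fin D.d))
    (hc : ∀ n : D.Pts η, c n ∈ D.maxCells ∧ D.HalfOpen η (c n) (n.1 : N)) (k : ℕ)
    [Fintype {n : D.Pts η // D.ndeg n.1 = k}] (n : {n : D.Pts η // D.ndeg n.1 = k}) :
    ∃ (row : {n : D.Pts η // D.ndeg n.1 = k} → MvPolynomial (Fin D.d) ℂ) (u : ℝ → ℂ)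
      (L : {n : D.Pts η // D.ndeg n.1 = k} → ℂ),
      (∀ y, ∑ p, MvPolynomial.eval y (row p) • D.x p.1.1 ∈ D.boxPart hη k ⊔ D.ZPart η y k) ∧
      (∀ p, Tendsto (fun s : ℝ => u s *
        MvPolynomial.eval (fun j => ((s ^ ψ (D.e j) : ℝ) : ℂ)) (row p) *
          ((s ^ (-ψ (p.1.1 : N)) : ℝ) : ℂ)) (𝓝[>] 0) (𝓝 (L p))) ∧
      L n = 1 ∧ ∀ p, L p ≠ 0 → p ≠ n → l (c p.1) η < l (c n.1) η := by
  classical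
  by_cases hB : (n.1.1 : N) ∈ D.B η
  · refine ⟨Pi.single n 1, fun s => ((s ^ ψ (n.1.1 : N) : ℝ) : ℂ), Pi.single n 1, fun y => ?_,
      fun p => ?_, by simp, fun p hp hpn => absurd (by simp [hpn]) hp⟩
    · rw [Finset.sum_eq_single n (fun p _ hp => by simp [hp]) (by simp)]
      refine Submodule.mem_sup_left (Submodule.subset_span ⟨⟨_, hB⟩, n.2, ?_⟩)
      simp [bpt]
    · rcases eq_or_ne p n with rfl | hpn
      · refine tendsto_const_nhds.congr' ?_
        filter_upwards [self_mem_nhdsWithin] with s hs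
        have hs : 0 < s := hs
        simp only [Pi.single_eq_same, map_one, mul_one]
        rw [← Complex.ofReal_mul, ← Real.rpow_add hs]
        simp
      · simp [hpn]
  obtain ⟨I, hI, i, hi, q, hq, hnI, hqI⟩ := n.1.exists_eq_add hη hB
  -- the coordinate of `e_i`, as a linear form on the lattice
  let μ : N →ₗ[ℤ] ℂ := (Complex.ofRealCLM.toLinearMap.restrictScalars ℤ).comp
    (((D.coord I i).restrictScalars ℤ).comp N.subtype)
  have hμ : ∀ j ∈ I, μ (D.e j) = if i = j then 1 else 0 := fun j hj => by
    have : μ (D.e j) = ((D.coord I i (D.e j) : ℝ) : ℂ) := rfl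
    rw [this, coord_e hI hi hj]
    split_ifs <;> simp
  have hqj : ∀ j, D.Enters η ((q.1 + D.ept j : D.points) : N) := fun j => by
    rw [add_comm]
    exact q.2.add_mem (D.e_mem j)
  have hdeg : ∀ j, D.ndeg (q.1 + D.ept j) = k := fun j => by
    rw [← n.2, hq, ndeg_add, ndeg_add, ndeg_ept, ndeg_ept]
  have hdegq : D.ndeg q.1 + 1 = k := by rw [← hdeg i, ndeg_add, ndeg_ept]
  let a : Fin D.d → ℝ := fun j =>
    ψ (q.1 : N) + ψ (D.e j) - ψ ((q.1 + D.ept j : D.points) : N)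
  have ha : ∀ j, 0 ≤ a j := fun j => by
    obtain ⟨hJ, hjJ⟩ := hc ⟨_, hqj j⟩
    exact sub_nonneg.2 (h.add_le hJ q.1.2 (D.e_mem j) (hjJ.mem_simplexCone hJ))
  refine ⟨fun p => ∑ j, if q.1 + D.ept j = p.1.1 then
      MvPolynomial.C (μ (D.e j)) * MvPolynomial.X j else 0,
    fun s => ((s ^ ψ (q.1 : N) : ℝ) : ℂ),
    fun p => ∑ j, if q.1 + D.ept j = p.1.1 then μ (D.e j) * (if a j = 0 then 1 else 0) else 0,
    fun y => ?_, fun p => ?_, ?_, fun p hp hpn => ?_⟩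
  · refine Submodule.mem_sup_right (Submodule.subset_span ⟨μ, q, hdegq, ?_⟩)
    rw [Zlin_mul_x]
    simp only [map_sum, Finset.sum_smul]
    rw [Finset.sum_comm]
    refine Finset.sum_congr rfl fun j _ => ?_
    rw [Finset.sum_eq_single ⟨⟨_, hqj j⟩, hdeg j⟩]
    · simp
    · intro p _ hp
      rw [if_neg fun heq => hp (Subtype.ext (Subtype.ext heq.symm)), map_zero, zero_smul]
    · simp
  · have : Tendsto (fun s : ℝ => ∑ j, if q.1 + D.ept j = p.1.1 then
        μ (D.e j) * ((s ^ a j : ℝ) : ℂ) else 0) (𝓝[>] 0)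
        (𝓝 (∑ j, if q.1 + D.ept j = p.1.1 then μ (D.e j) * (if a j = 0 then 1 else 0) else 0)) := by
      refine tendsto_finsetSum _ fun j _ => ?_
      by_cases hj : q.1 + D.ept j = p.1.1
      · simp only [if_pos hj]
        exact (tendsto_ofReal_rpow (ha j)).const_mul _
      · simp only [if_neg hj]
        exact tendsto_const_nhds
    refine this.congr' ?_
    filter_upwards [self_mem_nhdsWithin] with s hs
    have hs : 0 < s := hs
    rw [map_sum, Finset.mul_sum, Finset.sum_mul]
    refine Finset.sum_congr rfl fun j _ => ?_
    split_ifs with hj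
    · have : s ^ a j = s ^ ψ (q.1 : N) * s ^ ψ (D.e j) * s ^ (-ψ (p.1.1 : N)) := by
        rw [← Real.rpow_add hs, ← Real.rpow_add hs, ← hj]
        rfl
      rw [this]
      push_cast
      simp only [map_mul, MvPolynomial.eval_C, MvPolynomial.eval_X]
      ring
    · simp
  · beta_reduce
    rw [Finset.sum_eq_single i]
    · have hai : a i = 0 := by
        have h1 := h.eq I hI _ (hqI.mem_simplexCone hI)
        have h2 := h.eq I hI _ (hnI.mem_simplexCone hI)
        have h3 : ψ (D.e i) = l I (D.e i) := h.eq I hI _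
          ((mem_simplexCone_iff_coord hI).2 fun j hj => by
            rw [coord_e hI hj hi]; split_ifs <;> norm_num)
        have h4 : ((n.1.1 : N) : V) = ((q.1 : N) : V) + D.e i := by rw [hq]; rfl
        change ψ (q.1 : N) + ψ (D.e i) - ψ ((q.1 + D.ept i : D.points) : N) = 0
        rw [← hq]
        rw [h2, h4, map_add, h1, h3]
        ring
      rw [if_pos hq.symm, hμ i hi, if_pos rfl, if_pos hai, one_mul]
    · intro j _ hj
      refine if_neg fun heq => hj ?_
      have : D.ept j = D.ept i := by
        refine Subtype.ext ?_
        have := congrArg (fun p : D.points => (p : N)) (heq.trans hq)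
        simpa using this
      exact D.e_injective (Subtype.ext_iff.1 this)
    · simp
  · obtain ⟨j, -, hj⟩ := Finset.exists_ne_zero_of_sum_ne_zero hp
    have hjp : q.1 + D.ept j = p.1.1 := by
      by_contra hcon
      exact hj (if_neg hcon)
    rw [if_pos hjp] at hj
    have haj : a j = 0 := by
      by_contra hcon
      exact hj (by rw [if_neg hcon, mul_zero])
    have hjI : j ∉ I := by
      intro hjI
      rw [hμ j hjI] at hj
      have hij : i = j := by
        by_contra hcon
        exact hj (by rw [if_neg hcon, zero_mul])
      subst hij
      exact hpn (Subtype.ext (Subtype.ext (hjp.symm.trans hq.symm)))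
    have hcn : c n.1 = I := (hc n.1).2.unique hη (hc n.1).1 hI hnI
    rw [hcn]
    refine h.apply_lt hη hI (hc p.1).1 hqI hjI ?_ (sub_eq_zero.1 haj)
    have := (hc p.1).2
    rwa [← hjp] at this

/-- In every degree, the points of the boxes span the quotient for generic weights. -/
lemma exists_polynomial_degree (hη : D.IsGeneric η) (k : ℕ) :
    ∃ P : MvPolynomial (Fin D.d) ℂ, P ≠ 0 ∧ ∀ y, MvPolynomial.eval y P ≠ 0 →
      ∀ p : D.Pts η, D.ndeg p.1 = k → D.x p.1 ∈ D.boxPart hη k ⊔ D.ZPart η y k := by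
  classical
  obtain ⟨ψ, l, h⟩ := D.exists_isSupport
  choose c hc using fun n : D.Pts η => n.2.exists_halfOpen
  have hfin : Finite {n : D.Pts η // D.ndeg n.1 = k} := by
    have := (D.finite_ndeg_le k).to_subtype
    refine Finite.of_injective
      (β := {n : D.points | D.ndeg n ≤ k}) (fun n => ⟨n.1.1, n.2.le⟩) fun n n' hn => ?_
    have h1 := congrArg Subtype.val hn
    exact Subtype.ext (Subtype.ext h1)
  have := Fintype.ofFinite {n : D.Pts η // D.ndeg n.1 = k}
  choose row u L hrow htend hdiag hlt using D.exists_row hη h c hc k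
  let W : Matrix {n : D.Pts η // D.ndeg n.1 = k} {n : D.Pts η // D.ndeg n.1 = k}
    (MvPolynomial (Fin D.d) ℂ) := Matrix.of row
  refine ⟨W.det, ?_, fun y hy p hp => ?_⟩
  · refine W.det_ne_zero_of_tendsto _ u _ (Matrix.of L) ?_ htend
    rw [Matrix.det_eq_one_of_rank_lt (Matrix.of L) (fun n => l (c n.1) η) hdiag hlt]
    exact one_ne_zero
  · rw [RingHom.map_det] at hy
    exact Matrix.mem_of_sum_smul_mem _ hy (fun p => D.x p.1.1) _ (fun n => hrow n y) ⟨p, hp⟩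

/-- For generic weights, the points of the boxes span the quotient in all degrees at once. There
are none in degrees above the rank `r`, so it suffices to consider the degrees up to `r + 1`. -/
lemma exists_polynomial (hη : D.IsGeneric η) :
    ∃ P : MvPolynomial (Fin D.d) ℂ, P ≠ 0 ∧ ∀ y, MvPolynomial.eval y P ≠ 0 →
      ∀ p : D.Pts η, D.x p.1 ∈ D.boxPart hη (D.ndeg p.1) ⊔ D.ZPart η y (D.ndeg p.1) := by
  choose P hP0 hP using D.exists_polynomial_degree hη
  refine ⟨∏ k ∈ Finset.range (finrank ℤ N + 2), P k, Finset.prod_ne_zero_iff.2 fun k _ => hP0 k,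
    fun y hy => ?_⟩
  rw [map_prod, Finset.prod_ne_zero_iff] at hy
  have hsmall : ∀ p : D.Pts η, D.ndeg p.1 ≤ finrank ℤ N + 1 →
      D.x p.1 ∈ D.boxPart hη (D.ndeg p.1) ⊔ D.ZPart η y (D.ndeg p.1) := fun p hp =>
    hP _ y (hy _ (Finset.mem_range.2 (by omega))) p rfl
  have hbox : ∀ k, finrank ℤ N < k → D.boxPart hη k = ⊥ := by
    intro k hk
    rw [boxPart, Submodule.span_eq_bot]
    rintro _ ⟨b, hb, -⟩
    exact absurd (D.ndeg_bpt_le hη b) (by omega)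
  have hbig : ∀ j, ∀ p : D.Pts η, D.ndeg p.1 = finrank ℤ N + 1 + j →
      D.x p.1 ∈ D.ZPart η y (D.ndeg p.1) := by
    intro j
    induction j with
    | zero =>
      intro p hp
      have := hsmall p (by omega)
      rwa [hbox _ (by omega), bot_sup_eq] at this
    | succ j ih =>
      intro p hp
      have hpB : (p.1 : N) ∉ D.B η := by
        intro hB
        have h1 := D.ndeg_bpt_le hη ⟨_, hB⟩
        have h2 : (D.bpt hη ⟨_, hB⟩).1 = p.1 := by simp [bpt]
        rw [h2] at h1
        omega
      obtain ⟨I, -, i, -, q, hq, -⟩ := p.exists_eq_add hη hpB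
      have hdeg : D.ndeg p.1 = D.ndeg q.1 + 1 := by rw [hq, ndeg_add, ndeg_ept]
      have hmem := ih q (by omega)
      rw [hdeg, hq, x_add]
      refine Submodule.span_induction (p := fun f _ =>
        f * D.x (D.ept i) ∈ D.ZPart η y (D.ndeg q.1 + 1)) ?_ ?_ ?_ ?_ hmem
      · rintro _ ⟨μ, q', hq', rfl⟩
        refine Submodule.subset_span ⟨μ, ⟨q'.1 + D.ept i, ?_⟩, ?_, ?_⟩
        · rw [add_comm]
          exact q'.2.add_mem (D.e_mem i)
        · rw [ndeg_add, ndeg_ept, hq']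
        · rw [x_add, mul_assoc]
      · simp
      · intro f g _ _ hf hg
        rw [add_mul]
        exact add_mem hf hg
      · intro t f _ hf
        rw [smul_mul_assoc]
        exact Submodule.smul_mem _ _ hf
  intro p
  rcases le_or_gt (D.ndeg p.1) (finrank ℤ N + 1) with hle | hgt
  · exact hsmall p hle
  · exact Submodule.mem_sup_right (hbig (D.ndeg p.1 - (finrank ℤ N + 1)) p (by omega))

end GradedConeData

/-! ### Freeness from counting dimensions -/

section Counting

variable {𝕜 A σ β : Type*} [Field 𝕜] [CommRing A] [Algebra 𝕜 A] {r : ℕ} (x : σ → A) (w : σ → ℕ)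
  (ι : β → σ) (z : Fin r → A)

/-- The product of the monomial with exponent `α` in the elements `z_j` with `x_b`. -/
def monomialMul (p : β × (Fin r →₀ ℕ)) : A := (∏ j, z j ^ p.2 j) * x (ι p.1)

lemma mul_monomialMul (j : Fin r) (p : β × (Fin r →₀ ℕ)) :
    z j * monomialMul x ι z p = monomialMul x ι z (p.1, p.2 + Finsupp.single j 1) := by
  have : ∏ i, z i ^ (Finsupp.single j 1 : Fin r →₀ ℕ) i = z j := by
    rw [Finset.prod_eq_single j (fun i _ hi => by simp [hi.symm]) (by simp)]
    simp
  simp only [monomialMul, Finsupp.add_apply, pow_add, Finset.prod_mul_distrib, this]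
  ring

variable {x w ι z}

/-- If the `x_b` span modulo the `z_j` in every degree, then the products of monomials in the `z_j`
with the `x_b` span. -/
lemma mem_span_monomialMul
    (hspan : ∀ p, x p ∈ Submodule.span 𝕜 {f | ∃ b, w (ι b) = w p ∧ f = x (ι b)} ⊔
      Submodule.span 𝕜 {f | ∃ j q, w q + 1 = w p ∧ f = z j * x q}) (p : σ) :
    x p ∈ Submodule.span 𝕜
      (monomialMul x ι z '' {q | w (ι q.1) + q.2.degree = w p}) := by
  induction hk : w p using Nat.strong_induction_on generalizing p with
  | _ k ih =>
    subst hk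
    refine SetLike.le_def.1 (sup_le (Submodule.span_le.2 ?_) (Submodule.span_le.2 ?_)) (hspan p)
    · rintro _ ⟨b, hb, rfl⟩
      exact Submodule.subset_span ⟨(b, 0), by simpa using hb, by simp [monomialMul]⟩
    · rintro _ ⟨j, q, hq, rfl⟩
      have h1 := Submodule.mem_map_of_mem (f := LinearMap.mulLeft 𝕜 (z j))
        (ih (w q) (by omega) q rfl)
      rw [Submodule.map_span] at h1
      refine Submodule.span_mono ?_ h1
      rintro _ ⟨_, ⟨p', hp', rfl⟩, rfl⟩
      refine ⟨_, ?_, (mul_monomialMul x ι z j p').symm⟩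
      have hp' : w (ι p'.1) + p'.2.degree = w q := hp'
      change w (ι p'.1) + (p'.2 + Finsupp.single j 1).degree = w p
      rw [map_add, Finsupp.degree_single]
      omega

/-- If moreover there are as many of these products in every degree as there are `x_p`, then they
are linearly independent. -/
lemma linearIndependent_monomialMul (hx : LinearIndependent 𝕜 x)
    (hfin : ∀ k, {p | w p ≤ k}.Finite) (Φ : β × (Fin r →₀ ℕ) ≃ σ)
    (hΦ : ∀ p, w (Φ p) = w (ι p.1) + p.2.degree)
    (hspan : ∀ p, x p ∈ Submodule.span 𝕜 {f | ∃ b, w (ι b) = w p ∧ f = x (ι b)} ⊔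
      Submodule.span 𝕜 {f | ∃ j q, w q + 1 = w p ∧ f = z j * x q}) :
    LinearIndependent 𝕜 (monomialMul x ι z) := by
  have key : ∀ k, LinearIndepOn 𝕜 (monomialMul x ι z) {q | w (ι q.1) + q.2.degree ≤ k} := by
    intro k
    let e : {q : β × (Fin r →₀ ℕ) | w (ι q.1) + q.2.degree ≤ k} ≃ {p | w p ≤ k} :=
      Φ.subtypeEquiv fun q => by simp [hΦ]
    have := (hfin k).fintype
    have := Fintype.ofEquiv _ e.symm
    change LinearIndependent 𝕜 _
    rw [linearIndependent_iff_card_le_finrank_span, Fintype.card_congr e,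
      ← finrank_span_eq_card (hx.comp (fun p : {p | w p ≤ k} => p.1) Subtype.val_injective)]
    have : Module.Finite 𝕜 (Submodule.span 𝕜 (Set.range
        fun q : {q : β × (Fin r →₀ ℕ) | w (ι q.1) + q.2.degree ≤ k} => monomialMul x ι z q)) :=
      Module.Finite.span_of_finite 𝕜 (Set.finite_range _)
    refine Submodule.finrank_mono (Submodule.span_le.2 ?_)
    rintro _ ⟨⟨p, hp⟩, rfl⟩
    refine Submodule.span_mono ?_ (mem_span_monomialMul hspan p)
    rintro _ ⟨q, hq, rfl⟩
    have hq : w (ι q.1) + q.2.degree = w p := hq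
    have hp : w p ≤ k := hp
    exact ⟨⟨q, hq.trans_le hp⟩, rfl⟩
  rw [linearIndependent_iff_finset_linearIndependent]
  intro s
  obtain ⟨k, hk⟩ := (s.image fun q => w (ι q.1) + q.2.degree).exists_le
  exact (key k).mono fun q hq => hk _ (Finset.mem_image_of_mem _ hq)

/-- Under the same hypotheses the `x_b` are linearly independent modulo the `z_j`. -/
lemma linearCombination_eq_zero_of_mem (hx : LinearIndependent 𝕜 x)
    (hfin : ∀ k, {p | w p ≤ k}.Finite) (Φ : β × (Fin r →₀ ℕ) ≃ σ)
    (hΦ : ∀ p, w (Φ p) = w (ι p.1) + p.2.degree)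
    (hspan : ∀ p, x p ∈ Submodule.span 𝕜 {f | ∃ b, w (ι b) = w p ∧ f = x (ι b)} ⊔
      Submodule.span 𝕜 {f | ∃ j q, w q + 1 = w p ∧ f = z j * x q}) (c : β →₀ 𝕜)
    (hc : Finsupp.linearCombination 𝕜 (x ∘ ι) c ∈
      Submodule.span 𝕜 {f | ∃ j q, f = z j * x q}) : c = 0 := by
  have hli := linearIndependent_monomialMul hx hfin Φ hΦ hspan
  have h0 : ∀ b, monomialMul x ι z (b, 0) = x (ι b) := fun b => by simp [monomialMul]
  have hli0 : LinearIndependent 𝕜 (x ∘ ι) := by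
    convert hli.comp (fun b => (b, 0)) (fun b b' h => (Prod.ext_iff.1 h).1) using 1
    ext b
    simp [h0]
  have hle : Submodule.span 𝕜 {f | ∃ j q, f = z j * x q} ≤
      Submodule.span 𝕜 (monomialMul x ι z '' {q | q.2 ≠ 0}) := by
    rw [Submodule.span_le]
    rintro _ ⟨j, q, rfl⟩
    have h1 := Submodule.mem_map_of_mem (f := LinearMap.mulLeft 𝕜 (z j))
      (mem_span_monomialMul hspan q)
    rw [Submodule.map_span] at h1
    refine Submodule.span_mono ?_ h1
    rintro _ ⟨_, ⟨p, -, rfl⟩, rfl⟩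
    refine ⟨_, ?_, (mul_monomialMul x ι z j p).symm⟩
    intro h
    have := DFunLike.congr_fun h j
    simp at this
  have hdisj := hli.disjoint_span_image (s := {q | q.2 = 0}) (t := {q | q.2 ≠ 0})
    (Set.disjoint_left.2 fun q h1 h2 => h2 h1)
  have hmem : Finsupp.linearCombination 𝕜 (x ∘ ι) c ∈
      Submodule.span 𝕜 (monomialMul x ι z '' {q | q.2 = 0}) := by
    rw [Finsupp.linearCombination_apply]
    refine Submodule.sum_mem _ fun b _ => Submodule.smul_mem _ _ (Submodule.subset_span ?_)
    exact ⟨(b, 0), rfl, h0 b⟩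
  have := Submodule.disjoint_def.1 hdisj _ hmem (hle hc)
  exact linearIndependent_iff.1 hli0 c this

variable {F E : Type*} [AddCommGroup F] [Module 𝕜 F] [AddCommGroup E] [Module 𝕜 E]
  {incl : F →ₗ[𝕜] A} {π : F →ₗ[𝕜] E} {X : σ → F}

/-- The classes of the `x_b` are linearly independent in the quotient `E` of `F ⊆ A` by the
combinations of the `z_j x_q`. -/
lemma linearIndependent_quotient (hX : ∀ p, incl (X p) = x p)
    (hker : ∀ f, π f = 0 → incl f ∈ Submodule.span 𝕜 {f | ∃ j q, f = z j * x q})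
    (hx : LinearIndependent 𝕜 x) (hfin : ∀ k, {p | w p ≤ k}.Finite) (Φ : β × (Fin r →₀ ℕ) ≃ σ)
    (hΦ : ∀ p, w (Φ p) = w (ι p.1) + p.2.degree)
    (hspan : ∀ p, x p ∈ Submodule.span 𝕜 {f | ∃ b, w (ι b) = w p ∧ f = x (ι b)} ⊔
      Submodule.span 𝕜 {f | ∃ j q, w q + 1 = w p ∧ f = z j * x q}) :
    LinearIndependent 𝕜 ((π ∘ X) ∘ ι) := by
  rw [linearIndependent_iff]
  intro c hc
  refine linearCombination_eq_zero_of_mem hx hfin Φ hΦ hspan c ?_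
  have h1 : π (Finsupp.linearCombination 𝕜 (X ∘ ι) c) = 0 := by
    rw [← hc, Finsupp.apply_linearCombination]
    rfl
  have h2 : incl (Finsupp.linearCombination 𝕜 (X ∘ ι) c) =
      Finsupp.linearCombination 𝕜 (x ∘ ι) c := by
    rw [Finsupp.apply_linearCombination]
    congr 2
    ext b
    exact hX (ι b)
  rw [← h2]
  exact hker _ h1

/-- In the quotient, every `x_p` is a combination of those `x_b` which have the same degree. -/
lemma mem_span_quotient (hX : ∀ p, incl (X p) = x p) (hinj : Function.Injective incl)
    (hker : ∀ j q f, incl f = z j * x q → π f = 0) (hex : ∀ j q, ∃ f, incl f = z j * x q)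
    (hspan : ∀ p, x p ∈ Submodule.span 𝕜 {f | ∃ b, w (ι b) = w p ∧ f = x (ι b)} ⊔
      Submodule.span 𝕜 {f | ∃ j q, w q + 1 = w p ∧ f = z j * x q}) (p : σ) :
    (π ∘ X) p ∈ Submodule.span 𝕜 {f | ∃ b, w (ι b) = w p ∧ f = (π ∘ X) (ι b)} := by
  have hle : Submodule.span 𝕜 {f | ∃ b, w (ι b) = w p ∧ f = x (ι b)} ⊔
      Submodule.span 𝕜 {f | ∃ j q, w q + 1 = w p ∧ f = z j * x q} ≤
      ((Submodule.span 𝕜 {f | ∃ b, w (ι b) = w p ∧ f = (π ∘ X) (ι b)}).comap π).map incl := by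
    refine sup_le (Submodule.span_le.2 ?_) (Submodule.span_le.2 ?_)
    · rintro _ ⟨b, hb, rfl⟩
      exact ⟨X (ι b), Submodule.subset_span ⟨b, hb, rfl⟩, hX _⟩
    · rintro _ ⟨j, q, -, rfl⟩
      obtain ⟨f, hf⟩ := hex j q
      refine ⟨f, ?_, hf⟩
      rw [SetLike.mem_coe, Submodule.mem_comap, hker j q f hf]
      exact zero_mem _
  obtain ⟨f, hf, hfp⟩ := hle (hspan p)
  rw [← hX p] at hfp
  rw [hinj hfp] at hf
  exact hf

end Counting

/-! ### Graded bases -/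

section GradedBasis

variable {𝕜 E σ β : Type*} [Field 𝕜] [AddCommGroup E] [Module 𝕜 E] {y : σ → E}
  {w : σ → ℕ} {ι : β → σ}

lemma span_degree_eq
    (hmem : ∀ p, y p ∈ Submodule.span 𝕜 {f | ∃ b, w (ι b) = w p ∧ f = y (ι b)}) (k : ℕ) :
    Submodule.span 𝕜 {f | ∃ p, w p = k ∧ f = y p} =
      Submodule.span 𝕜 ((y ∘ ι) '' {b | w (ι b) = k}) := by
  apply le_antisymm
  · rw [Submodule.span_le]
    rintro _ ⟨p, rfl, rfl⟩
    refine Submodule.span_mono ?_ (hmem p)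
    rintro _ ⟨b, hb, rfl⟩
    exact ⟨b, hb, rfl⟩
  · refine Submodule.span_mono ?_
    rintro _ ⟨b, hb, rfl⟩
    exact ⟨ι b, hb, rfl⟩

lemma span_box_eq_top (htop : Submodule.span 𝕜 (Set.range y) = ⊤)
    (hmem : ∀ p, y p ∈ Submodule.span 𝕜 {f | ∃ b, w (ι b) = w p ∧ f = y (ι b)}) :
    Submodule.span 𝕜 (Set.range (y ∘ ι)) = ⊤ := by
  rw [eq_top_iff, ← htop, Submodule.span_le]
  rintro _ ⟨p, rfl⟩
  refine Submodule.span_mono ?_ (hmem p)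
  rintro _ ⟨b, -, rfl⟩
  exact ⟨b, rfl⟩

lemma isInternal_span_degree (hli : LinearIndependent 𝕜 (y ∘ ι))
    (htop : Submodule.span 𝕜 (Set.range y) = ⊤)
    (hmem : ∀ p, y p ∈ Submodule.span 𝕜 {f | ∃ b, w (ι b) = w p ∧ f = y (ι b)}) :
    DirectSum.IsInternal fun k => Submodule.span 𝕜 {f | ∃ p, w p = k ∧ f = y p} := by
  rw [DirectSum.isInternal_submodule_iff_iSupIndep_and_iSup_eq_top]
  constructor
  · intro k
    simp only [span_degree_eq hmem, ← Submodule.span_iUnion, ← Set.image_iUnion]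
    refine hli.disjoint_span_image (Set.disjoint_left.2 fun b hb hb' => ?_)
    simp only [Set.mem_iUnion] at hb'
    obtain ⟨j, hj, hb'⟩ := hb'
    exact hj (hb'.symm.trans hb)
  · rw [← Submodule.span_iUnion, eq_top_iff, ← htop]
    refine Submodule.span_mono ?_
    rintro _ ⟨p, rfl⟩
    exact Set.mem_iUnion.2 ⟨w p, p, rfl, rfl⟩

lemma finrank_span_degree [Finite β] (hli : LinearIndependent 𝕜 (y ∘ ι))
    (hmem : ∀ p, y p ∈ Submodule.span 𝕜 {f | ∃ b, w (ι b) = w p ∧ f = y (ι b)}) (k : ℕ) :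
    finrank 𝕜 (Submodule.span 𝕜 {f | ∃ p, w p = k ∧ f = y p}) =
      Nat.card {b // w (ι b) = k} := by
  have := Fintype.ofFinite {b // w (ι b) = k}
  rw [span_degree_eq hmem, Nat.card_eq_fintype_card,
    ← finrank_span_eq_card (hli.comp (fun b : {b // w (ι b) = k} => b.1) Subtype.val_injective),
    Set.image_eq_range]
  rfl

end GradedBasis

/-! ### Generating functions -/

/-- The number of monomials of degree `k` in `r` variables is a coefficient of `(1 - X) ^ (-r)`. -/
lemma coeff_mk_one_pow (r k : ℕ) :
    PowerSeries.coeff k ((PowerSeries.mk 1 : ℤ⟦X⟧) ^ r) =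
      Nat.card {α : Fin r →₀ ℕ // α.degree = k} := by
  have h1 : (PowerSeries.mk 1 : ℤ⟦X⟧) ^ r = ∏ _j : Fin r, (PowerSeries.mk 1 : ℤ⟦X⟧) := by simp
  rw [h1, PowerSeries.coeff_prod]
  have h2 : ∀ α : Fin r →₀ ℕ, α ∈ Finset.finsuppAntidiag Finset.univ k ↔ α.degree = k := fun α => by
    simp [Finset.mem_finsuppAntidiag, Finsupp.degree_eq_sum]
  have h3 : Nat.card {α : Fin r →₀ ℕ // α.degree = k} =
      (Finset.finsuppAntidiag (Finset.univ : Finset (Fin r)) k).card :=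
    Nat.subtype_card _ h2
  simp [h3]

/-- The generating function of a disjoint union of translates of `ℕ ^ r`. -/
lemma one_sub_X_pow_mul_mk_card {σ β : Type*} [Finite β] {r : ℕ} (w : σ → ℕ) (v : β → ℕ)
    (Φ : β × (Fin r →₀ ℕ) ≃ σ) (hΦ : ∀ p, w (Φ p) = v p.1 + p.2.degree) :
    (1 - PowerSeries.X) ^ r * (PowerSeries.mk fun k => (Nat.card {p // w p = k} : ℤ)) =
      PowerSeries.mk fun k => (Nat.card {b // v b = k} : ℤ) := by
  classical
  have := Fintype.ofFinite β
  have h1 : (PowerSeries.mk fun k => (Nat.card {b // v b = k} : ℤ)) =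
      ∑ b, (PowerSeries.X : ℤ⟦X⟧) ^ v b := by
    ext k
    simp [PowerSeries.coeff_X_pow, Fintype.card_subtype, eq_comm]
  have h2 : (PowerSeries.mk fun k => (Nat.card {p // w p = k} : ℤ)) =
      (∑ b, (PowerSeries.X : ℤ⟦X⟧) ^ v b) * (PowerSeries.mk 1 : ℤ⟦X⟧) ^ r := by
    ext k
    have hfin : ∀ j, Finite {α : Fin r →₀ ℕ // α.degree = j} := fun j =>
      Finite.of_injective (β := Finset.finsuppAntidiag (Finset.univ : Finset (Fin r)) j)
        (fun α => ⟨α.1, by simpa [Finset.mem_finsuppAntidiag, Finsupp.degree_eq_sum] using α.2⟩)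
        fun α α' h => by simpa [Subtype.ext_iff] using h
    have hfin' : ∀ b, Finite {α : Fin r →₀ ℕ // v b + α.degree = k} := fun b => by
      have := hfin (k - v b)
      exact Finite.of_injective (β := {α : Fin r →₀ ℕ // α.degree = k - v b})
        (fun α => ⟨α.1, by have := α.2; omega⟩) fun α α' h => by simpa [Subtype.ext_iff] using h
    let e : {p // w p = k} ≃ Σ b, {α : Fin r →₀ ℕ // v b + α.degree = k} :=
      { toFun := fun p => ⟨(Φ.symm p.1).1, (Φ.symm p.1).2, by rw [← hΦ]; simpa using p.2⟩
        invFun := fun q => ⟨Φ (q.1, q.2.1), by rw [hΦ]; exact q.2.2⟩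
        left_inv := fun p => by simp
        right_inv := fun q => by
          obtain ⟨b, α, h⟩ := q
          refine Sigma.ext (by simp) ?_
          refine (Subtype.heq_iff_coe_eq ?_).2 (by simp)
          simp }
    rw [PowerSeries.coeff_mk, Nat.card_congr e, Nat.card_sigma, Finset.sum_mul, map_sum]
    push_cast
    refine Finset.sum_congr rfl fun b _ => ?_
    rw [PowerSeries.coeff_X_pow_mul']
    split_ifs with hle
    · rw [coeff_mk_one_pow]
      congr 1
      refine Nat.card_congr (Equiv.subtypeEquivRight fun α => ?_)
      omega
    · have : IsEmpty {α : Fin r →₀ ℕ // v b + α.degree = k} :=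
        ⟨fun α => hle (by have := α.2; omega)⟩
      simp
  rw [h1, h2, mul_left_comm, ← mul_pow, mul_comm (1 - PowerSeries.X) (PowerSeries.mk 1),
    PowerSeries.mk_one_mul_one_sub_eq_one, one_pow, mul_one]

namespace GradedConeData

variable {V : Type*} [NormedAddCommGroup V] [NormedSpace ℝ V] {N : Submodule ℤ V}
  (D : GradedConeData N)

/-! ### The semigroup ring -/

lemma linearIndependent_x : LinearIndependent ℂ D.x :=
  (AddMonoidAlgebra.basis D.points ℂ).linearIndependent

lemma eq_sum_x (f : D.R) : f = ∑ n ∈ f.coeff.support, f.coeff n • D.x n := by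
  conv_lhs => rw [← AddMonoidAlgebra.sum_coeff_single f]
  exact Finset.sum_congr rfl fun n _ => by simp [x]

lemma span_x_eq_top : Submodule.span ℂ (Set.range D.x) = ⊤ :=
  (AddMonoidAlgebra.basis D.points ℂ).span_eq

lemma mem_span_x_of_mem_Ropen {f : D.R} (hf : f ∈ D.Ropen) :
    f ∈ Submodule.span ℂ (Set.range fun n : {n : D.points // D.IsInner n} => D.x n.1) := by
  rw [D.eq_sum_x f]
  exact Submodule.sum_mem _ fun n hn =>
    Submodule.smul_mem _ _ (Submodule.subset_span ⟨⟨n, hf n hn⟩, rfl⟩)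

lemma span_xopen_eq_top :
    Submodule.span ℂ (Set.range fun n : {n : D.points // D.IsInner n} => D.xopen n.1 n.2) = ⊤ := by
  rw [eq_top_iff]
  intro f _
  have h := D.mem_span_x_of_mem_Ropen f.2
  have h' : (fun n : {n : D.points // D.IsInner n} => D.x n.1) =
      (D.Ropen.subtype.restrictScalars ℂ) ∘ fun n => D.xopen n.1 n.2 := rfl
  rw [h', Set.range_comp, ← Submodule.map_span] at h
  obtain ⟨g, hg, hgf⟩ := h
  have : g = f := Subtype.ext hgf
  exact this ▸ hg

variable {r : ℕ} (m : Basis (Fin r) ℂ (N →ₗ[ℤ] ℂ))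

lemma Zlin_eq_sum (y : Fin D.d → ℂ) (μ : N →ₗ[ℤ] ℂ) :
    D.Zlin y μ = ∑ j, m.repr μ j • D.Zlin y (m j) := by
  conv_lhs => rw [← m.sum_repr μ]
  simp only [Zlin, Finset.smul_sum, smul_smul]
  rw [Finset.sum_comm]
  refine Finset.sum_congr rfl fun i _ => ?_
  rw [← Finset.sum_smul, LinearMap.sum_apply, Finset.sum_mul]
  simp [mul_assoc]

/-- The weights `exp (2 π i a_i)`. -/
def weight {D : GradedConeData N} (a : Fin D.d → ℂ) : Fin D.d → ℂ :=
  fun i => Complex.exp (2 * Real.pi * Complex.I * a i)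

variable {η : V}

lemma ZPart_le (y : Fin D.d → ℂ) (k : ℕ) : D.ZPart η y k ≤
    Submodule.span ℂ {f | ∃ j, ∃ q : D.Pts η, D.ndeg q.1 + 1 = k ∧
      f = D.Zlin y (m j) * D.x q.1} := by
  rw [ZPart, Submodule.span_le]
  rintro _ ⟨μ, q, hq, rfl⟩
  rw [D.Zlin_eq_sum m, Finset.sum_mul]
  refine Submodule.sum_mem _ fun j _ => ?_
  rw [smul_mul_assoc]
  exact Submodule.smul_mem _ _ (Submodule.subset_span ⟨j, q, hq, rfl⟩)

/-- Elements of `Z · J`, where `J` is an ideal spanned by monomials. -/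
lemma mul_mem_span (a : Fin D.d → ℂ) {f : D.R} (hf : f ∈ D.Z m a) {J : Ideal D.R}
    (hJ : ∀ g ∈ J, g ∈ Submodule.span ℂ (Set.range fun q : D.Pts η => D.x q.1)) {g : D.R}
    (hg : g ∈ J) : f * g ∈ Submodule.span ℂ {f | ∃ j, ∃ q : D.Pts η,
      f = D.Zelt m a j * D.x q.1} := by
  obtain ⟨c, rfl⟩ := (Ideal.mem_span_range_iff_exists_fun).1 hf
  rw [Finset.sum_mul]
  refine Submodule.sum_mem _ fun j _ => ?_
  rw [mul_comm (c j), mul_assoc]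
  have h1 := Submodule.mem_map_of_mem (f := LinearMap.mulLeft ℂ (D.Zelt m a j))
    (hJ _ (J.mul_mem_left (c j) hg))
  rw [Submodule.map_span] at h1
  refine Submodule.span_mono ?_ h1
  rintro _ ⟨_, ⟨q, rfl⟩, rfl⟩
  exact ⟨j, q, rfl⟩

/-! ### The quotients `R / ZR` and `R^{open} / Z R^{open}` -/

/-- The quotient map from `R` to `R / ZR`, as a linear map over `ℂ`. -/
def mkQ (a : Fin D.d → ℂ) : D.R →ₗ[ℂ] D.Q m a := (Submodule.mkQ (D.Z m a)).restrictScalars ℂ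

/-- The quotient map from `R^{open}` to `R^{open} / Z R^{open}`, as a linear map over `ℂ`. -/
def mkQopen (a : Fin D.d → ℂ) : D.Ropen →ₗ[ℂ] D.Qopen m a :=
  (Submodule.mkQ (D.Z m a • ⊤ : Submodule D.R D.Ropen)).restrictScalars ℂ

lemma mkQ_eq_zero_iff (a : Fin D.d → ℂ) (f : D.R) : D.mkQ m a f = 0 ↔ f ∈ D.Z m a :=
  Submodule.Quotient.mk_eq_zero _

lemma mkQopen_eq_zero_iff (a : Fin D.d → ℂ) (f : D.Ropen) :
    D.mkQopen m a f = 0 ↔ f ∈ (D.Z m a • ⊤ : Submodule D.R D.Ropen) :=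
  Submodule.Quotient.mk_eq_zero _

lemma mkQ_surjective (a : Fin D.d → ℂ) : Function.Surjective (D.mkQ m a) :=
  (D.Z m a).mkQ_surjective

lemma mkQopen_surjective (a : Fin D.d → ℂ) : Function.Surjective (D.mkQopen m a) :=
  (D.Z m a • ⊤ : Submodule D.R D.Ropen).mkQ_surjective

lemma Zelt_mem (a : Fin D.d → ℂ) (j : Fin r) : D.Zelt m a j ∈ D.Z m a :=
  Ideal.subset_span ⟨j, rfl⟩

lemma boxPart_sup_ZPart_le [FiniteDimensional ℝ V] (hη : D.IsGeneric η) (a : Fin D.d → ℂ) (k : ℕ) :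
    D.boxPart hη k ⊔ D.ZPart η (weight a) k ≤
      Submodule.span ℂ {f | ∃ b, D.ndeg (D.bpt hη b).1 = k ∧ f = D.x (D.bpt hη b).1} ⊔
      Submodule.span ℂ {f | ∃ j, ∃ q : D.Pts η, D.ndeg q.1 + 1 = k ∧
        f = D.Zelt m a j * D.x q.1} :=
  sup_le_sup le_rfl (D.ZPart_le m (weight a) k)

variable [FiniteDimensional ℝ V] [DiscreteTopology N] [IsZLattice ℝ N]

/-- What follows for a space `E` in which the classes of the box points are a basis, and every class
is a combination of classes of box points of its own degree. -/
lemma bijective_finite_isInternal_gradedDim (hη : D.IsGeneric η) {E : Type*} [AddCommGroup E]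
    [Module ℂ E] (Y : D.Pts η → E) (hli : LinearIndependent ℂ (Y ∘ D.bpt hη))
    (htop : Submodule.span ℂ (Set.range Y) = ⊤)
    (hmem : ∀ p, Y p ∈ Submodule.span ℂ
      {f | ∃ b, D.ndeg (D.bpt hη b).1 = D.ndeg p.1 ∧ f = Y (D.bpt hη b)}) :
    Function.Bijective (Finsupp.linearCombination ℂ (Y ∘ D.bpt hη)) ∧ Module.Finite ℂ E ∧
      (DirectSum.IsInternal fun k : ℕ =>
        Submodule.span ℂ {f | ∃ p : D.Pts η, D.ndeg p.1 = k ∧ f = Y p}) ∧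
      gradedDim (fun k : ℕ => Submodule.span ℂ {f | ∃ p : D.Pts η, D.ndeg p.1 = k ∧ f = Y p}) =
        (1 - PowerSeries.X) ^ finrank ℤ N *
          PowerSeries.mk fun k => (Nat.card {p : D.Pts η // D.ndeg p.1 = k} : ℤ) := by
  have := D.finite_B hη
  have hspan := span_box_eq_top (w := fun p : D.Pts η => D.ndeg p.1) htop hmem
  refine ⟨⟨hli, ?_⟩, ?_, isInternal_span_degree (w := fun p : D.Pts η => D.ndeg p.1) hli htop hmem,
    ?_⟩
  · rw [← LinearMap.range_eq_top, Finsupp.range_linearCombination, hspan]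
  · exact ⟨Submodule.fg_def.2 ⟨_, Set.finite_range _, hspan⟩⟩
  · rw [one_sub_X_pow_mul_mk_card (fun p : D.Pts η => D.ndeg p.1)
      (fun b => D.ndeg (D.bpt hη b).1) (D.translateEquiv hη) (D.ndeg_translateEquiv hη)]
    ext k
    rw [gradedDim, PowerSeries.coeff_mk, PowerSeries.coeff_mk,
      finrank_span_degree (w := fun p : D.Pts η => D.ndeg p.1) hli hmem]

lemma finite_Pts_ndeg_le (k : ℕ) : {p : D.Pts η | D.ndeg p.1 ≤ k}.Finite :=
  (D.finite_ndeg_le k).preimage Subtype.val_injective.injOn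

/-- If the box points span modulo `Z`, their classes form a basis of `R / ZR`. -/
lemma Q_basis_of_mem_sup (m : Basis (Fin (finrank ℤ N)) ℂ (N →ₗ[ℤ] ℂ)) (a : Fin D.d → ℂ)
    (h : ∀ p : D.Pts D.ξ, D.x p.1 ∈ D.boxPart D.isGeneric_ξ (D.ndeg p.1) ⊔
      D.ZPart D.ξ (weight a) (D.ndeg p.1)) :
    Function.Bijective (D.spanMap m a) ∧ Module.Finite ℂ (D.Q m a) ∧
      DirectSum.IsInternal (D.gradedPart m a) ∧ gradedDim (D.gradedPart m a) = D.S := by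
  have hξ : ∀ n : D.points, D.Enters D.ξ (n : N) := fun n => D.enters_ξ_iff.2 n.2
  have hspan := fun p => D.boxPart_sup_ZPart_le m D.isGeneric_ξ a _ (h p)
  have hrange : ∀ g, g ∈ Submodule.span ℂ (Set.range fun q : D.Pts D.ξ => D.x q.1) := fun g => by
    have hg : g ∈ Submodule.span ℂ (Set.range D.x) := D.span_x_eq_top ▸ Submodule.mem_top
    refine Submodule.span_mono ?_ hg
    rintro _ ⟨n, rfl⟩
    exact ⟨⟨n, hξ n⟩, rfl⟩
  have hX : ∀ p : D.Pts D.ξ, (LinearMap.id : D.R →ₗ[ℂ] D.R) (D.x p.1) = D.x p.1 := fun _ => rfl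
  have hli := linearIndependent_quotient (π := D.mkQ m a) (w := fun p : D.Pts D.ξ => D.ndeg p.1)
    (z := D.Zelt m a) hX
    (fun f hf => by
      have := D.mul_mem_span m a ((D.mkQ_eq_zero_iff m a f).1 hf) (J := ⊤)
        (fun g _ => hrange g) (g := 1) trivial
      rwa [mul_one] at this)
    (D.linearIndependent_x.comp _ Subtype.val_injective) D.finite_Pts_ndeg_le
    (D.translateEquiv D.isGeneric_ξ) (D.ndeg_translateEquiv D.isGeneric_ξ) hspan
  have hmem := mem_span_quotient (π := D.mkQ m a) (w := fun p : D.Pts D.ξ => D.ndeg p.1)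
    (z := D.Zelt m a) hX Function.injective_id
    (fun j q f hf => (D.mkQ_eq_zero_iff m a f).2 (by
      have hf : f = _ := hf
      rw [hf]
      exact Ideal.mul_mem_right _ _ (D.Zelt_mem m a j)))
    (fun j q => ⟨_, rfl⟩) hspan
  have htop : Submodule.span ℂ (Set.range (D.mkQ m a ∘ fun p : D.Pts D.ξ => D.x p.1)) = ⊤ := by
    rw [Set.range_comp, ← Submodule.map_span, Submodule.eq_top_iff'.2 hrange, Submodule.map_top,
      LinearMap.range_eq_top]
    exact D.mkQ_surjective m a
  obtain ⟨c1, c2, c3, c4⟩ := D.bijective_finite_isInternal_gradedDim D.isGeneric_ξ _ hli htop hmem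
  have hpart : D.gradedPart m a = fun k : ℕ => Submodule.span ℂ {f | ∃ p : D.Pts D.ξ,
      D.ndeg p.1 = k ∧ f = (D.mkQ m a ∘ fun p : D.Pts D.ξ => D.x p.1) p} := by
    ext1 k
    refine congrArg _ (Set.ext fun f => ⟨?_, ?_⟩)
    · rintro ⟨n, hn, rfl⟩
      exact ⟨⟨n, hξ n⟩, D.ndeg_eq_iff.2 hn, rfl⟩
    · rintro ⟨p, hp, rfl⟩
      exact ⟨p.1, D.ndeg_eq_iff.1 hp, rfl⟩
  have hcard : ∀ k : ℕ, Nat.card {n : D.points // D.deg n = k} =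
      Nat.card {p : D.Pts D.ξ // D.ndeg p.1 = k} := fun k =>
    Nat.card_congr
      { toFun := fun n => ⟨⟨n.1, hξ n.1⟩, D.ndeg_eq_iff.2 n.2⟩
        invFun := fun p => ⟨p.1.1, D.ndeg_eq_iff.1 p.2⟩
        left_inv := fun _ => rfl
        right_inv := fun _ => rfl }
  refine ⟨c1, c2, ?_, ?_⟩
  · rw [hpart]
    exact c3
  · rw [hpart, c4, S]
    simp only [hcard]

/-- If the box points span modulo `Z`, their classes form a basis of `R^{open} / Z R^{open}`. -/
lemma Qopen_basis_of_mem_sup (m : Basis (Fin (finrank ℤ N)) ℂ (N →ₗ[ℤ] ℂ)) (a : Fin D.d → ℂ)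
    (h : ∀ p : D.Pts (-D.ξ), D.x p.1 ∈ D.boxPart D.isGeneric_ξ.neg (D.ndeg p.1) ⊔
      D.ZPart (-D.ξ) (weight a) (D.ndeg p.1)) :
    Function.Bijective (D.spanMapOpen m a) ∧ Module.Finite ℂ (D.Qopen m a) ∧
      DirectSum.IsInternal (D.gradedPartOpen m a) ∧
      gradedDim (D.gradedPartOpen m a) = D.Topen := by
  have hξ : ∀ n : D.points, D.Enters (-D.ξ) (n : N) ↔ D.IsInner n := fun n => D.enters_neg_ξ_iff
  have hspan := fun p => D.boxPart_sup_ZPart_le m D.isGeneric_ξ.neg a _ (h p)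
  let X : D.Pts (-D.ξ) → D.Ropen := fun p => D.xopen p.1 ((hξ _).1 p.2)
  let incl : D.Ropen →ₗ[ℂ] D.R := D.Ropen.subtype.restrictScalars ℂ
  have hX : ∀ p : D.Pts (-D.ξ), incl (X p) = D.x p.1 := fun _ => rfl
  have hrange : ∀ g ∈ D.Ropen,
      g ∈ Submodule.span ℂ (Set.range fun q : D.Pts (-D.ξ) => D.x q.1) := fun g hg => by
    refine Submodule.span_mono ?_ (D.mem_span_x_of_mem_Ropen hg)
    rintro _ ⟨n, rfl⟩
    exact ⟨⟨n.1, (hξ _).2 n.2⟩, rfl⟩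
  have hker : ∀ f, D.mkQopen m a f = 0 → incl f ∈ Submodule.span ℂ
      {f | ∃ j, ∃ q : D.Pts (-D.ξ), f = D.Zelt m a j * D.x q.1} := by
    intro f hf
    rw [mkQopen_eq_zero_iff] at hf
    refine Submodule.smul_induction_on hf (fun z hz g _ => ?_) fun f g hf hg => ?_
    · exact D.mul_mem_span m a hz hrange g.2
    · rw [map_add]
      exact add_mem hf hg
  have hli := linearIndependent_quotient (π := D.mkQopen m a)
    (w := fun p : D.Pts (-D.ξ) => D.ndeg p.1) (z := D.Zelt m a) hX hker
    (D.linearIndependent_x.comp _ Subtype.val_injective) D.finite_Pts_ndeg_le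
    (D.translateEquiv D.isGeneric_ξ.neg) (D.ndeg_translateEquiv D.isGeneric_ξ.neg) hspan
  have hmem := mem_span_quotient (π := D.mkQopen m a)
    (w := fun p : D.Pts (-D.ξ) => D.ndeg p.1) (z := D.Zelt m a) hX Subtype.val_injective
    (fun j q f hf => (D.mkQopen_eq_zero_iff m a f).2 (by
      have hf : f = D.Zelt m a j • X q := Subtype.ext hf
      rw [hf]
      exact Submodule.smul_mem_smul (D.Zelt_mem m a j) trivial))
    (fun j q => ⟨D.Zelt m a j • X q, rfl⟩) hspan
  have htop : Submodule.span ℂ (Set.range (D.mkQopen m a ∘ X)) = ⊤ := by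
    have hXtop : Submodule.span ℂ (Set.range X) = ⊤ := by
      rw [eq_top_iff, ← span_xopen_eq_top]
      refine Submodule.span_mono ?_
      rintro _ ⟨n, rfl⟩
      exact ⟨⟨n.1, (hξ _).2 n.2⟩, rfl⟩
    rw [Set.range_comp, ← Submodule.map_span, hXtop, Submodule.map_top, LinearMap.range_eq_top]
    exact D.mkQopen_surjective m a
  obtain ⟨c1, c2, c3, c4⟩ :=
    D.bijective_finite_isInternal_gradedDim D.isGeneric_ξ.neg _ hli htop hmem
  have hpart : D.gradedPartOpen m a = fun k : ℕ => Submodule.span ℂ {f | ∃ p : D.Pts (-D.ξ),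
      D.ndeg p.1 = k ∧ f = (D.mkQopen m a ∘ X) p} := by
    ext1 k
    refine congrArg _ (Set.ext fun f => ⟨?_, ?_⟩)
    · rintro ⟨n, hn, hd, rfl⟩
      exact ⟨⟨n, (hξ n).2 hn⟩, D.ndeg_eq_iff.2 hd, rfl⟩
    · rintro ⟨p, hp, rfl⟩
      exact ⟨p.1, (hξ _).1 p.2, D.ndeg_eq_iff.1 hp, rfl⟩
  have hcard : ∀ k : ℕ, Nat.card {n : D.points // D.IsInner n ∧ D.deg n = k} =
      Nat.card {p : D.Pts (-D.ξ) // D.ndeg p.1 = k} := fun k =>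
    Nat.card_congr
      { toFun := fun n => ⟨⟨n.1, (hξ _).2 n.2.1⟩, D.ndeg_eq_iff.2 n.2.2⟩
        invFun := fun p => ⟨p.1.1, (hξ _).1 p.1.2, D.ndeg_eq_iff.1 p.2⟩
        left_inv := fun _ => rfl
        right_inv := fun _ => rfl }
  refine ⟨c1, c2, ?_, ?_⟩
  · rw [hpart]
    exact c3
  · rw [hpart, c4, Topen]
    simp only [hcard]

end GradedConeData

end

theorem mainTheorem4 {V : Type*} [NormedAddCommGroup V] [NormedSpace ℝ V] [FiniteDimensional ℝ V]
    (N : Submodule ℤ V) [DiscreteTopology N] [IsZLattice ℝ N] (D : GradedConeData N)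
    (m : Module.Basis (Fin (Module.finrank ℤ N)) ℂ (N →ₗ[ℤ] ℂ)) :
    ∃ P : MvPolynomial (Fin D.d) ℂ, P ≠ 0 ∧
      ∀ a : Fin D.d → ℂ,
        MvPolynomial.eval (fun i => Complex.exp (2 * Real.pi * Complex.I * a i)) P ≠ 0 →
          (Function.Bijective (D.spanMap m a) ∧ Function.Bijective (D.spanMapOpen m a)) ∧
          (Module.Finite ℂ (D.Q m a) ∧ DirectSum.IsInternal (D.gradedPart m a) ∧
            gradedDim (D.gradedPart m a) = D.S) ∧
          (Module.Finite ℂ (D.Qopen m a) ∧ DirectSum.IsInternal (D.gradedPartOpen m a) ∧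
            gradedDim (D.gradedPartOpen m a) = D.Topen) := by
  obtain ⟨P, hP0, hP⟩ := D.exists_polynomial D.isGeneric_ξ
  obtain ⟨P', hP0', hP'⟩ := D.exists_polynomial D.isGeneric_ξ.neg
  refine ⟨P * P', mul_ne_zero hP0 hP0', fun a ha => ?_⟩
  rw [map_mul] at ha
  obtain ⟨h1, h2, h3, h4⟩ := D.Q_basis_of_mem_sup m a (hP _ (left_ne_zero_of_mul ha))
  obtain ⟨k1, k2, k3, k4⟩ := D.Qopen_basis_of_mem_sup m a (hP' _ (right_ne_zero_of_mul ha))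
  exact ⟨⟨h1, k1⟩, ⟨h2, h3, h4⟩, ⟨k2, k3, k4⟩⟩
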